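/- Let $0\le k\le n$, let $(X,\omega,J)$ be an almost Kähler manifold of real dimension $2n$ (that is, $\omega$ is a smooth closed 2-form, $J$ a smooth almost complex structure with $\omega(J\cdot,J\cdot)=\omega$, and $g=\omega(\cdot,J\cdot)$ is a Riemannian metric), and let $Y\subset X$ be an immersed (for instance embedded) coisotropic submanifold of dimension $n+k$, i.e. $(TY)^\omega\subset TY$, where $(T_yY)^\omega=\{v\in T_yX : \omega(v,w)=0 \text{ for all } w\in T_yY\}$. Equip $Y$ with the metric $g_Y$ induced by $g$. The leaves of the null foliation of $Y$ are the maximal connected integral manifolds of the rank $n-k$ distribution $E=(TY)^\omega$ on $Y$. For a smooth local $g_Y$-orthonormal frame $e_{k+1},\dots,e_n$ of $E$, put $\nu_Y=e^*_{k+1}\wedge\dots\wedge e^*_n$ with $e^*_\alpha=g_Y(e_\alpha,\cdot)$; this local $(n-k)$-form on $Y$ (the leafwise volume form) is independent of the frame up to sign. Theorem. Let $\Sigma$ be a leaf of the null foliation of $Y$. Then $\Sigma$ is a minimal submanifold of $(Y,g_Y)$ (its mean curvature vector, the trace of its second fundamental form in $Y$, vanishes identically) if and only if $\nu_Y$ is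 relatively closed on $\Sigma$, that is, at every point $y\in\Sigma$, $$d\nu_Y(X_1,\dots,X_{n-k+1})=0$$ for all $X_1,\dots,X_{n-k}\in E_y$ and all $X_{n-k+1}\in T_yY$. -/

import Mathlib

open Set Filter
open scoped Manifold ContDiff Topology

noncomputable section

namespace Coisotropic

/-! ### Multilinear algebra -/

section Algebra

variable {V W : Type*} [AddCommGroup V] [Module ℝ V] [TopologicalSpace V]
  [AddCommGroup W] [Module ℝ W] [TopologicalSpace W]

/-- The wedge product `θ₀ ∧ ⋯ ∧ θ_{p-1}` of `p` covectors, normalized so that its value on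
`(v₀, …, v_{p-1})` is the determinant of the matrix `(θᵢ (vⱼ))`. -/
def wedge {p : ℕ} (θ : Fin p → V →L[ℝ] ℝ) : V [⋀^Fin p]→L[ℝ] ℝ :=
  { (Matrix.detRowAlternating (R := ℝ) (n := Fin p)).compLinearMap
      (LinearMap.pi fun i => (θ i : V →ₗ[ℝ] ℝ)) with
    cont := by
      change Continuous fun v : Fin p → V =>
        Matrix.det (Matrix.of fun j i : Fin p => θ i (v j))
      apply Continuous.matrix_det
      fun_prop }

theorem wedge_apply {p : ℕ} (θ : Fin p → V →L[ℝ] ℝ) (v : Fin p → V) :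
    wedge θ v = Matrix.det (Matrix.of fun i j : Fin p => θ i (v j)) := by
  rw [← Matrix.det_transpose]
  rfl

/-- The pullback `A^*B` of a bilinear form along a linear map, `(A^*B)(u, v) = B(Au, Av)`. -/
def pullbackBilin (A : V →L[ℝ] W) (B : W →L[ℝ] W →L[ℝ] ℝ) : V →L[ℝ] V →L[ℝ] ℝ :=
  (ContinuousLinearMap.precomp ℝ A).comp (B.comp A)

@[simp] theorem pullbackBilin_apply (A : V →L[ℝ] W) (B : W →L[ℝ] W →L[ℝ] ℝ) (u v : V) :
    pullbackBilin A B u v = B (A u) (A v) := rfl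

/-- An alternating bilinear form on a finite-dimensional space, regarded as an exterior form of
degree two. -/
def twoForm [IsTopologicalAddGroup V] [ContinuousSMul ℝ V] [T2Space V] [FiniteDimensional ℝ V]
    (B : V →L[ℝ] V →L[ℝ] ℝ) (hB : ∀ v, B v v = 0) : V [⋀^Fin 2]→L[ℝ] ℝ where
  toFun v := B (v 0) (v 1)
  map_update_add' := by
    intro _ v i x y
    fin_cases i <;> simp [Function.update]
  map_update_smul' := by
    intro _ v i c x
    fin_cases i <;> simp [Function.update]
  map_eq_zero_of_eq' := by
    intro v i j h hij
    fin_cases i <;> fin_cases j <;> simp_all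
  cont := by
    let T := toEuclidean (E := V)
    have h := ContinuousLinearMap.continuous₂
      (pullbackBilin (W := V) (T.symm : EuclideanSpace ℝ (Fin (Module.finrank ℝ V)) →L[ℝ] V) B)
    have h' : Continuous fun v : Fin 2 → V => (T (v 0), T (v 1)) := by fun_prop
    convert h.comp h' using 1
    funext v
    simp

end Algebra

/-! ### Tensor calculus on manifolds, in charts -/

section Manifolds

variable {E : Type*} [NormedAddCommGroup E] [NormedSpace ℝ E]
  {M : Type*} [TopologicalSpace M] [ChartedSpace E M]

instance (x : M) : T2Space (TangentSpace 𝓘(ℝ, E) x) :=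
  inferInstanceAs (T2Space E)

instance [FiniteDimensional ℝ E] (x : M) : FiniteDimensional ℝ (TangentSpace 𝓘(ℝ, E) x) :=
  inferInstanceAs (FiniteDimensional ℝ E)

/-- The differential of the preferred chart at `y` (at the point `y` itself). -/
def chartDeriv (y : M) : TangentSpace 𝓘(ℝ, E) y →L[ℝ] E :=
  mfderiv 𝓘(ℝ, E) 𝓘(ℝ, E) (extChartAt 𝓘(ℝ, E) y) y

/-- The differential at the point `z` of the inverse of the preferred chart at `y`. -/
def chartSymmDeriv (y : M) (z : E) :
    E →L[ℝ] TangentSpace 𝓘(ℝ, E) ((extChartAt 𝓘(ℝ, E) y).symm z) :=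
  mfderiv 𝓘(ℝ, E) 𝓘(ℝ, E) (extChartAt 𝓘(ℝ, E) y).symm z

/-- A differential form of degree `p` on `M`, read in the preferred chart at `y`. -/
def chartForm {p : ℕ} (ν : ∀ x : M, TangentSpace 𝓘(ℝ, E) x [⋀^Fin p]→L[ℝ] ℝ) (y : M) :
    E → E [⋀^Fin p]→L[ℝ] ℝ :=
  fun z => (ν ((extChartAt 𝓘(ℝ, E) y).symm z)).compContinuousLinearMap (chartSymmDeriv y z)

/-- The exterior derivative at `y` of a differential form on the manifold `M`. -/
def mextDeriv {p : ℕ} (ν : ∀ x : M, TangentSpace 𝓘(ℝ, E) x [⋀^Fin p]→L[ℝ] ℝ) (y : M) :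
    TangentSpace 𝓘(ℝ, E) y [⋀^Fin (p + 1)]→L[ℝ] ℝ :=
  (extDeriv (chartForm ν y) (extChartAt 𝓘(ℝ, E) y y)).compContinuousLinearMap (chartDeriv y)

/-- A field of bilinear forms on `M` (for instance a Riemannian metric), read in the preferred
chart at `y`. -/
def chartBilin (g : ∀ x : M, TangentSpace 𝓘(ℝ, E) x →L[ℝ] TangentSpace 𝓘(ℝ, E) x →L[ℝ] ℝ)
    (y : M) : E → E →L[ℝ] E →L[ℝ] ℝ :=
  fun z => pullbackBilin (chartSymmDeriv y z) (g ((extChartAt 𝓘(ℝ, E) y).symm z))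

/-- The Christoffel symbols at `y` of the Levi-Civita connection of the Riemannian metric `g`, in
the preferred chart at `y`: `Γ(a, b)` is the vector with
`g(Γ(a, b), c) = (1/2) (D_a g (b, c) + D_b g (a, c) - D_c g (a, b))` for all `c`,
all in coordinates. -/
def christoffel (g : ∀ x : M, TangentSpace 𝓘(ℝ, E) x →L[ℝ] TangentSpace 𝓘(ℝ, E) x →L[ℝ] ℝ)
    (y : M) (a b : E) : E :=
  let z : E := extChartAt 𝓘(ℝ, E) y y
  let D : E →L[ℝ] E →L[ℝ] E →L[ℝ] ℝ := fderiv ℝ (chartBilin g y) z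
  (chartBilin g y z).inverse ((1 / 2 : ℝ) • (D a b + D b a - (D.flip a).flip b))

variable {F : Type*} [NormedAddCommGroup F] [NormedSpace ℝ F]
  {L : Type*} [TopologicalSpace L] [ChartedSpace F L]

/-- The second covariant derivative `(∇ dj)(a, b)` at `s` of a map `j` from `L` to the Riemannian
manifold `(M, g)`: the covariant derivative in direction `a`, for the pullback of the Levi-Civita
connection of `g`, of the vector field `dj(b)` along `j`, where `b` is extended by constant
coordinates in the chart of `L` at `s`. For an immersion `j` its component normal to `L` is the
second fundamental form of `L` in `M`. -/
def covHessian (g : ∀ x : M, TangentSpace 𝓘(ℝ, E) x →L[ℝ] TangentSpace 𝓘(ℝ, E) x →L[ℝ] ℝ)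
    (j : L → M) (s : L) (a b : TangentSpace 𝓘(ℝ, F) s) : TangentSpace 𝓘(ℝ, E) (j s) :=
  let f : F → E := writtenInExtChartAt 𝓘(ℝ, F) 𝓘(ℝ, E) s j
  let z : F := extChartAt 𝓘(ℝ, F) s s
  let a' : F := chartDeriv s a
  let b' : F := chartDeriv s b
  (chartDeriv (j s)).inverse
    (fderiv ℝ (fderiv ℝ f) z a' b' + christoffel g (j s) (fderiv ℝ f z a') (fderiv ℝ f z b'))

/-- `H` is the mean curvature vector at `s` of the `p`-dimensional submanifold immersed by `j` in
the Riemannian manifold `(M, g)`: it is normal to the submanifold, and it is the normal component of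
`∑ i, (∇ dj)(aᵢ, aᵢ)`, that is, the trace of the second fundamental form over an orthonormal basis
`a` of the tangent space for the induced metric. -/
def IsMeanCurvatureVector (p : ℕ)
    (g : ∀ x : M, TangentSpace 𝓘(ℝ, E) x →L[ℝ] TangentSpace 𝓘(ℝ, E) x →L[ℝ] ℝ)
    (j : L → M) (s : L) (H : TangentSpace 𝓘(ℝ, E) (j s)) : Prop :=
  (∀ u : TangentSpace 𝓘(ℝ, F) s, g (j s) H (mfderiv 𝓘(ℝ, F) 𝓘(ℝ, E) j s u) = 0) ∧
  ∀ a : Fin p → TangentSpace 𝓘(ℝ, F) s,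
    (∀ i l, g (j s) (mfderiv 𝓘(ℝ, F) 𝓘(ℝ, E) j s (a i)) (mfderiv 𝓘(ℝ, F) 𝓘(ℝ, E) j s (a l)) =
      if i = l then 1 else 0) →
    ∑ i, covHessian g j s (a i) (a i) - H ∈
      LinearMap.range (mfderiv 𝓘(ℝ, F) 𝓘(ℝ, E) j s).toLinearMap

/-- The `p`-dimensional submanifold immersed by `j` in the Riemannian manifold `(M, g)` is minimal:
its mean curvature vector vanishes identically. -/
def IsMinimalSubmanifold (p : ℕ)
    (g : ∀ x : M, TangentSpace 𝓘(ℝ, E) x →L[ℝ] TangentSpace 𝓘(ℝ, E) x →L[ℝ] ℝ)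
    (j : L → M) : Prop :=
  ∀ s : L, IsMeanCurvatureVector (F := F) p g j s 0

end Manifolds

/-! ### Almost Kähler manifolds and coisotropic submanifolds -/

section AlmostKahler

variable {E : Type*} [NormedAddCommGroup E] [NormedSpace ℝ E] [FiniteDimensional ℝ E]

/-- An almost Kähler structure `(ω, J)` on the manifold `X`: a smooth closed 2-form `ω` and a smooth
almost complex structure `J` compatible with it, so that `ω(·, J ·)` is a Riemannian metric (in
particular `ω` is nondegenerate, i.e. symplectic). -/
structure AlmostKahlerStructure (E : Type*) [NormedAddCommGroup E] [NormedSpace ℝ E]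
    [FiniteDimensional ℝ E] (X : Type*) [TopologicalSpace X] [ChartedSpace E X]
    [IsManifold 𝓘(ℝ, E) ∞ X] where
  /-- the symplectic form `ω` -/
  form : ∀ x : X, TangentSpace 𝓘(ℝ, E) x →L[ℝ] TangentSpace 𝓘(ℝ, E) x →L[ℝ] ℝ
  /-- the almost complex structure -/
  J : ∀ x : X, TangentSpace 𝓘(ℝ, E) x →L[ℝ] TangentSpace 𝓘(ℝ, E) x
  smooth_form : ContMDiff 𝓘(ℝ, E) (𝓘(ℝ, E).prod 𝓘(ℝ, E →L[ℝ] E →L[ℝ] ℝ)) ∞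
    (fun x => Bundle.TotalSpace.mk' (E →L[ℝ] E →L[ℝ] ℝ)
      (E := fun x : X => TangentSpace 𝓘(ℝ, E) x →L[ℝ] TangentSpace 𝓘(ℝ, E) x →L[ℝ] ℝ) x (form x))
  smooth_J : ContMDiff 𝓘(ℝ, E) (𝓘(ℝ, E).prod 𝓘(ℝ, E →L[ℝ] E)) ∞
    (fun x => Bundle.TotalSpace.mk' (E →L[ℝ] E)
      (E := fun x : X => TangentSpace 𝓘(ℝ, E) x →L[ℝ] TangentSpace 𝓘(ℝ, E) x) x (J x))
  alternating : ∀ x v, form x v v = 0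
  closed : ∀ x, mextDeriv (fun x => twoForm (form x) (alternating x)) x = 0
  J_sq : ∀ x v, J x (J x v) = -v
  form_J : ∀ x v w, form x (J x v) (J x w) = form x v w
  form_pos : ∀ x v, v ≠ 0 → 0 < form x v (J x v)

variable {X : Type*} [TopologicalSpace X] [ChartedSpace E X] [IsManifold 𝓘(ℝ, E) ∞ X]

/-- The Riemannian metric `g = ω(·, J ·)` of an almost Kähler manifold. -/
def AlmostKahlerStructure.metric (K : AlmostKahlerStructure E X) (x : X) :
    TangentSpace 𝓘(ℝ, E) x →L[ℝ] TangentSpace 𝓘(ℝ, E) x →L[ℝ] ℝ :=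
  (ContinuousLinearMap.precomp ℝ (K.J x)).comp (K.form x)

theorem AlmostKahlerStructure.metric_apply (K : AlmostKahlerStructure E X) (x : X)
    (v w : TangentSpace 𝓘(ℝ, E) x) : K.metric x v w = K.form x v (K.J x w) := rfl

variable {E' : Type*} [NormedAddCommGroup E'] [NormedSpace ℝ E']
  {Y : Type*} [TopologicalSpace Y] [ChartedSpace E' Y] [IsManifold 𝓘(ℝ, E') ∞ Y]

/-- The smooth map `ι` is an immersion whose image is coisotropic, `(TY)^ω ⊆ TY`. -/
structure IsCoisotropicSubmanifold (K : AlmostKahlerStructure E X) (ι : Y → X) : Prop where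
  smooth : ContMDiff 𝓘(ℝ, E') 𝓘(ℝ, E) ∞ ι
  immersion : ∀ y, Function.Injective (mfderiv 𝓘(ℝ, E') 𝓘(ℝ, E) ι y)
  coisotropic : ∀ (y : Y) (v : TangentSpace 𝓘(ℝ, E) (ι y)),
    (∀ u : TangentSpace 𝓘(ℝ, E') y, K.form (ι y) v (mfderiv 𝓘(ℝ, E') 𝓘(ℝ, E) ι y u) = 0) →
    ∃ u : TangentSpace 𝓘(ℝ, E') y, mfderiv 𝓘(ℝ, E') 𝓘(ℝ, E) ι y u = v

/-- The metric `g_Y` induced on `Y` by the metric of the ambient almost Kähler manifold. -/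
def inducedMetric (K : AlmostKahlerStructure E X) (ι : Y → X) (y : Y) :
    TangentSpace 𝓘(ℝ, E') y →L[ℝ] TangentSpace 𝓘(ℝ, E') y →L[ℝ] ℝ :=
  pullbackBilin (mfderiv 𝓘(ℝ, E') 𝓘(ℝ, E) ι y) (K.metric (ι y))

/-- The null distribution of `Y`, the kernel `TY ∩ (TY)^ω` of the restriction of `ω` to `TY`
(so it is `(TY)^ω` if `Y` is coisotropic), as a distribution on `Y`. -/
def nullDistribution (K : AlmostKahlerStructure E X) (ι : Y → X) (y : Y) :
    Submodule ℝ (TangentSpace 𝓘(ℝ, E') y) :=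
  LinearMap.ker (pullbackBilin (mfderiv 𝓘(ℝ, E') 𝓘(ℝ, E) ι y) (K.form (ι y))).toLinearMap

variable {F : Type*} [NormedAddCommGroup F] [NormedSpace ℝ F]

/-- The map `j` is an injective immersion of `L` as an integral manifold of the null distribution:
its tangent space at each point is the null distribution there. -/
structure IsIntegralManifold (K : AlmostKahlerStructure E X) (ι : Y → X)
    {L : Type*} [TopologicalSpace L] [ChartedSpace F L] (j : L → Y) : Prop where
  smooth : ContMDiff 𝓘(ℝ, F) 𝓘(ℝ, E') ∞ j
  injective : Function.Injective j
  immersion : ∀ s, Function.Injective (mfderiv 𝓘(ℝ, F) 𝓘(ℝ, E') j s)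
  range_eq : ∀ s, LinearMap.range (mfderiv 𝓘(ℝ, F) 𝓘(ℝ, E') j s).toLinearMap =
    nullDistribution K ι (j s)

universe u

/-- The injective immersion `j : L → Y` is a leaf of the null foliation: `L` is a maximal connected
integral manifold of the null distribution. -/
structure IsLeaf (K : AlmostKahlerStructure E X) (ι : Y → X)
    {L : Type u} [TopologicalSpace L] [ChartedSpace F L] (j : L → Y) : Prop where
  connected : ConnectedSpace L
  integral : IsIntegralManifold (E' := E') (F := F) K ι j
  maximal : ∀ (L' : Type u) [TopologicalSpace L'] [ChartedSpace F L'] [IsManifold 𝓘(ℝ, F) ∞ L']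
    [ConnectedSpace L'] (j' : L' → Y), IsIntegralManifold (E' := E') (F := F) K ι j' →
    range j ⊆ range j' → range j' ⊆ range j

/-- A smooth `g_Y`-orthonormal frame `e` of the null distribution on the open set `U ⊆ Y`. These are
the vectors `e_{k+1}, …, e_n` of a frame `e₁, …, e_n, f₁, …, f_k` adapted to `Y`. -/
structure IsLeafFrame {p : ℕ} (K : AlmostKahlerStructure E X) (ι : Y → X)
    (U : Set Y) (e : Fin p → ∀ y : Y, TangentSpace 𝓘(ℝ, E') y) : Prop where
  isOpen : IsOpen U
  smooth : ∀ i, ContMDiffOn 𝓘(ℝ, E') (𝓘(ℝ, E').prod 𝓘(ℝ, E')) ∞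
    (fun y => (⟨y, e i y⟩ : TangentBundle 𝓘(ℝ, E') Y)) U
  span_eq : ∀ y ∈ U, Submodule.span ℝ (range fun i => e i y) = nullDistribution K ι y
  orthonormal : ∀ y ∈ U, ∀ i l,
    inducedMetric K ι y (e i y) (e l y) = if i = l then 1 else 0

/-- The local expression `e*_{k+1} ∧ ⋯ ∧ e*_n` of the leafwise volume form `ν_Y`, where
`e*_i = g_Y(e_i, ·)` are covectors of the dual coframe of an adapted orthonormal frame. -/
def leafVolumeForm {p : ℕ} (K : AlmostKahlerStructure E X) (ι : Y → X)
    (e : Fin p → ∀ y : Y, TangentSpace 𝓘(ℝ, E') y) (y : Y) :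
    TangentSpace 𝓘(ℝ, E') y [⋀^Fin p]→L[ℝ] ℝ :=
  wedge fun i => inducedMetric K ι y (e i y)

/-- The leafwise volume form `ν_Y`, of degree `p`, is relatively closed on `S ⊆ Y`: at each point of
`S`, `dν_Y (v₁, …, v_{p+1}) = 0` whenever `v₁, …, v_p` are tangent to the null foliation. The form
`ν_Y` is determined up to sign by the local adapted frames, and the condition is imposed for all of
them. -/
def IsRelativelyClosedOn (p : ℕ) (K : AlmostKahlerStructure E X) (ι : Y → X) (S : Set Y) : Prop :=
  ∀ (U : Set Y) (e : Fin p → ∀ y : Y, TangentSpace 𝓘(ℝ, E') y), IsLeafFrame (E' := E') K ι U e →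
    ∀ y ∈ U ∩ S, ∀ v : Fin (p + 1) → TangentSpace 𝓘(ℝ, E') y,
      (∀ i : Fin p, v i.castSucc ∈ nullDistribution K ι y) →
      mextDeriv (leafVolumeForm K ι e) y v = 0

end AlmostKahler

end Coisotropic

end

/-!
The theorem is the first variation formula for the leafwise volume. Write `N` for the null
distribution. Fix a point `y` of a leaf, an orthonormal frame `e₁, …, e_p` of `N` near `y`, and let
`θᵢ = g_Y(eᵢ, ·)`, so that `ν = θ₁ ∧ ⋯ ∧ θ_p`. If `w` is orthogonal to the leaf at `y`, then
`θᵢ(eₗ) = δᵢₗ` and `θᵢ(w) = 0` force `dν(w, e₁, …, e_p) = ∑ i, dθᵢ(w, eᵢ)` (`extDeriv_wedge_cons`). Since `eᵢ` has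
constant length, the Koszul expression of the Levi-Civita connection turns the right-hand side into
`-g(∑ i, ∇_{eᵢ} eᵢ, w)` (`extDeriv_wedge_metric`, `mextDeriv_leafVolumeForm_cons`).

The left-hand side carries all the information in relative closedness at `y`: an alternating form of
degree `p + 1` with `p` arguments in the `p`-dimensional space `N_y` is determined by its values on
`(w, e₁, …, e_p)`, and these vanish for `w ∈ N_y` (`eq_zero_of_map_cons_eq_zero`). On the right-hand
side, `∇_{eᵢ} eᵢ` agrees with the second covariant derivative `(∇ dj)(aᵢ, aᵢ)` of the parametrization
`j` of the leaf, `dj(aᵢ) = eᵢ`, up to a vector tangent to the leaf, because `eᵢ` is tangent to the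
leaf along the leaf (`covHessian_sub_covDerivSelf_mem_range`). So `ν` is relatively closed at `y`
with respect to the given frame if and only if the mean curvature, computed in the orthonormal basis
`a`, vanishes at `y` (`relativelyClosed_iff_sum_covHessian_mem_range`).

To pass from relative closedness, which speaks of frames, to minimality, which speaks of orthonormal
bases of a single tangent space, every orthonormal basis of `N_y` has to be extended to a local
frame (`exists_isLeafFrame`). This is where coisotropy enters: `N` is the full symplectic orthogonal
complement of `TY`, hence has constant rank (`finrank_nullDistribution`), so that kernel vectors of
the restricted symplectic form extend to smooth sections of the kernel, which are then
orthonormalized.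

All computations are made in the preferred chart at `y`, in which the differential of the chart at
`y` itself is the identity.
-/

noncomputable section

namespace Coisotropic

/-! ### Wedge products of covectors and alternating forms -/

section Wedge

variable {V : Type*} [NormedAddCommGroup V] [NormedSpace ℝ V]

theorem norm_wedge_le {p : ℕ} (θ : Fin p → V →L[ℝ] ℝ) :
    ‖wedge θ‖ ≤ p.factorial * ∏ i, ‖θ i‖ := by
  refine ContinuousAlternatingMap.opNorm_le_bound _ (by positivity) fun v => ?_
  rw [wedge_apply, Matrix.det_apply]
  calc ‖∑ σ : Equiv.Perm (Fin p), Equiv.Perm.sign σ • ∏ i, (Matrix.of fun i j => θ i (v j)) (σ i) i‖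
      ≤ ∑ _σ : Equiv.Perm (Fin p), (∏ i, ‖θ i‖) * ∏ i, ‖v i‖ := by
        refine norm_sum_le_of_le _ fun σ _ => ?_
        have h1 : ‖Equiv.Perm.sign σ • ∏ i, (Matrix.of fun i j => θ i (v j)) (σ i) i‖
            = ∏ i, ‖θ (σ i) (v i)‖ := by
          rcases Int.units_eq_one_or (Equiv.Perm.sign σ) with h | h <;> simp [h, norm_prod]
        rw [h1, ← Equiv.prod_comp σ fun i => ‖θ i‖, ← Finset.prod_mul_distrib]
        exact Finset.prod_le_prod (fun _ _ => norm_nonneg _) fun i _ => (θ (σ i)).le_opNorm _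
    _ = p.factorial * (∏ i, ‖θ i‖) * ∏ i, ‖v i‖ := by
        simp [Fintype.card_perm, mul_assoc]

theorem wedge_update_apply {p : ℕ} (θ : Fin p → V →L[ℝ] ℝ) (i : Fin p) (η : V →L[ℝ] ℝ)
    (v : Fin p → V) :
    wedge (Function.update θ i η) v =
      Matrix.det ((Matrix.of fun a b => θ a (v b)).updateRow i fun b => η (v b)) := by
  rw [wedge_apply]
  congr 1
  ext a b
  rcases eq_or_ne a i with rfl | h <;> simp [*]

/-- The wedge product of covectors, as a continuous multilinear map of the covectors. -/
def wedgeMultilinear (V : Type*) [NormedAddCommGroup V] [NormedSpace ℝ V] (p : ℕ) :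
    ContinuousMultilinearMap ℝ (fun _ : Fin p => V →L[ℝ] ℝ) (V [⋀^Fin p]→L[ℝ] ℝ) :=
  MultilinearMap.mkContinuous
    { toFun := wedge
      map_update_add' := by
        intro inst θ i x y
        obtain rfl : inst = instDecidableEqFin p := Subsingleton.elim _ _
        ext v
        rw [ContinuousAlternatingMap.add_apply]
        simp only [wedge_update_apply]
        rw [← Matrix.det_updateRow_add]
        rfl
      map_update_smul' := by
        intro inst θ i c x
        obtain rfl : inst = instDecidableEqFin p := Subsingleton.elim _ _
        ext v
        rw [ContinuousAlternatingMap.smul_apply]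
        simp only [wedge_update_apply]
        rw [smul_eq_mul, ← Matrix.det_updateRow_smul]
        rfl }
    p.factorial norm_wedge_le

@[simp] theorem wedgeMultilinear_apply {p : ℕ} (θ : Fin p → V →L[ℝ] ℝ) :
    wedgeMultilinear V p θ = wedge θ := rfl

/-- The exterior derivative of a wedge product of one-forms `θᵢ` evaluated on `(w, e₁, …, e_p)`
when `e` is dual to `θ` and `w` is annihilated by all `θᵢ`: it is `∑ i, dθᵢ (w, eᵢ)`. -/
theorem extDeriv_wedge_cons {p : ℕ} {θ : V → Fin p → V →L[ℝ] ℝ} {z : V}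
    {θ' : Fin p → V →L[ℝ] V →L[ℝ] ℝ}
    (hθ : ∀ i, HasFDerivAt (fun y => θ y i) (θ' i) z) {e : Fin p → V} {w : V}
    (he : ∀ i l, θ z i (e l) = if i = l then 1 else 0) (hw : ∀ i, θ z i w = 0) :
    extDeriv (fun y => wedge (θ y)) z (Fin.cons w e) = ∑ i, (θ' i w (e i) - θ' i (e i) w) := by
  have hd : HasFDerivAt (fun y => wedge (θ y))
      (((wedgeMultilinear V p).linearDeriv (θ z)).comp (ContinuousLinearMap.pi θ')) z :=
    ((wedgeMultilinear V p).hasFDerivAt (θ z)).comp z (hasFDerivAt_pi.2 hθ)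
  have hd' (a : V) (v : Fin p → V) : fderiv ℝ (fun y => wedge (θ y)) z a v =
      ∑ i, wedge (Function.update (θ z) i (θ' i a)) v := by
    rw [hd.fderiv]
    simp [ContinuousMultilinearMap.linearDeriv_apply, ContinuousAlternatingMap.sum_apply]
  rw [extDeriv, ContinuousAlternatingMap.alternatizeUncurryFin_apply, Fin.sum_univ_succ,
    Finset.sum_sub_distrib, sub_eq_add_neg, ← Finset.sum_neg_distrib]
  congr 1
  -- Differentiation along `w`: the matrix is the identity with row `i` replaced by `θ' i w`.
  · simp only [Fin.val_zero, pow_zero, one_smul, Fin.cons_zero, hd']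
    refine Finset.sum_congr rfl fun i _ => ?_
    rw [wedge_update_apply]
    have : Fin.removeNth 0 (Fin.cons w e : Fin (p + 1) → V) = e := by
      ext a; simp [Fin.removeNth]
    rw [this]
    have h1 : (Matrix.of fun a b => θ z a (e b)) = 1 := by
      ext a b
      simp [he, Matrix.one_apply]
    rw [h1, ← Matrix.cramer_transpose_apply]
    simp
  -- Differentiation along `eₘ`: the arguments are `w` and the `eₗ` with `l ≠ m`, so the first
  -- column is zero before differentiation, and only the term differentiating `θₘ` survives.
  · refine Finset.sum_congr rfl fun m _ => ?_
    obtain ⟨q, rfl⟩ : ∃ q, p = q + 1 := ⟨p - 1, by have := m.2; omega⟩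
    simp only [Fin.cons_succ, hd']
    have hv : Fin.removeNth m.succ (Fin.cons w e : Fin (q + 1 + 1) → V)
        = Fin.cons w (m.removeNth e) := by
      ext a
      refine Fin.cases ?_ (fun b => ?_) a <;> simp [Fin.removeNth]
    rw [hv, Finset.sum_eq_single m]
    · rw [wedge_update_apply, Matrix.det_succ_column_zero, Finset.sum_eq_single m]
      · have : Matrix.submatrix (Matrix.updateRow (Matrix.of fun a b =>
            θ z a ((Fin.cons w (m.removeNth e) : Fin (q + 1) → V) b)) m
            fun b => θ' m (e m) ((Fin.cons w (m.removeNth e) : Fin (q + 1) → V) b))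
            m.succAbove Fin.succ = 1 := by
          ext a b
          simp [Fin.removeNth, he, Matrix.one_apply]
        rw [this]
        have hm : ((-1 : ℝ) ^ (m : ℕ)) * (-1) ^ (m : ℕ) = 1 := by simp [← mul_pow]
        simp only [Matrix.updateRow_self, Fin.cons_zero, Matrix.det_one, Fin.val_succ, pow_succ,
          zsmul_eq_mul]
        push_cast
        linear_combination -(θ' m (e m) w) * hm
      · intro i _ hi
        simp [Matrix.updateRow_ne hi, hw]
      · simp
    · intro i _ hi
      rw [wedge_update_apply]
      -- row `m` vanishes, because `θₘ` annihilates `w` and all `eₗ` with `l ≠ m`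
      refine Matrix.det_eq_zero_of_row_eq_zero m fun b => ?_
      rw [Matrix.updateRow_ne hi.symm]
      refine Fin.cases ?_ (fun b => ?_) b
      · simp [hw]
      · simp [Fin.removeNth, he, (Fin.succAbove_ne m b).symm]
    · simp

end Wedge

section Alternating

variable {V : Type*} [AddCommGroup V] [Module ℝ V] {p : ℕ}

theorem map_cons_eq_zero_iff_map_snoc (α : V [⋀^Fin (p + 1)]→ₗ[ℝ] ℝ) (w : V)
    (v : Fin p → V) :
    α (Fin.cons w v) = 0 ↔ α (Fin.snoc (α := fun _ => V) v w) = 0 := by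
  have h : (Fin.cons w v : Fin (p + 1) → V) ∘ finRotate (p + 1) =
      Fin.snoc (α := fun _ => V) v w := by
    ext i
    refine Fin.lastCases ?_ (fun i => ?_) i
    · rw [Function.comp_apply, finRotate_last, Fin.cons_zero, Fin.snoc_last]
    · rw [Function.comp_apply, finRotate_apply, Fin.coeSucc_eq_succ, Fin.cons_succ,
        Fin.snoc_castSucc]
  rw [← h, α.map_perm]
  rcases Int.units_eq_one_or (Equiv.Perm.sign (finRotate (p + 1))) with h | h <;> simp [h]

/-- An alternating form of degree `p + 1` vanishes whenever its first `p` arguments lie in the span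
of `p` independent vectors `e`, as soon as it vanishes on `(w, e₁, …, e_p)` for all `w` in a
complement of this span. -/
theorem eq_zero_of_map_cons_eq_zero (α : V [⋀^Fin (p + 1)]→ₗ[ℝ] ℝ)
    {e : Fin p → V} (hli : LinearIndependent ℝ e) {P : V → Prop}
    (hP : ∀ v, ∃ n ∈ Submodule.span ℝ (range e), ∃ w, P w ∧ n + w = v)
    (h : ∀ w, P w → α (Fin.cons w e) = 0) (v : Fin (p + 1) → V)
    (hv : ∀ i : Fin p, v i.castSucc ∈ Submodule.span ℝ (range e)) : α v = 0 := by
  let b := Module.Basis.span hli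
  have hb : ∀ i, (b i : V) = e i := fun i => by simp [b, Module.Basis.span_apply]
  have hc : ∀ w, α (Fin.cons w e) = 0 := by
    intro w
    obtain ⟨n, hn, w', hw', rfl⟩ := hP w
    -- `p + 1` vectors in the span of `e` are dependent
    have h0 : α (Fin.cons n e) = 0 := by
      apply α.map_linearDependent
      rw [linearIndependent_finCons]
      exact fun h => h.2 hn
    have := α.toMultilinearMap.cons_add e n w'
    simp only [AlternatingMap.coe_multilinearMap] at this
    rw [this, h0, h w' hw', add_zero]
  -- on the span, the form `α (w, ·)` is a multiple of the determinant in the basis `e`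
  have hcurry : (α.curryLeft (v (Fin.last p))).compLinearMap
      (Submodule.span ℝ (range e)).subtype = 0 := by
    rw [← AlternatingMap.map_basis_eq_zero_iff b]
    have := hc (v (Fin.last p))
    simp only [AlternatingMap.compLinearMap_apply, AlternatingMap.curryLeft_apply_apply,
      Submodule.subtype_apply, hb]
    exact this
  have h2 : α (Fin.cons (v (Fin.last p)) fun i => v i.castSucc) = 0 := by
    have := DFunLike.congr_fun hcurry fun i : Fin p =>
      (⟨v i.castSucc, hv i⟩ : Submodule.span ℝ (range e))
    exact this
  rw [map_cons_eq_zero_iff_map_snoc] at h2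
  exact (congrArg α (Fin.snoc_init_self v)).symm.trans h2

end Alternating

/-! ### Metrics, tangent fields and frames in a vector space -/

section InnerProducts

variable {V : Type*} [NormedAddCommGroup V] [NormedSpace ℝ V]

theorem isInvertible_of_posDef [FiniteDimensional ℝ V] {B : V →L[ℝ] V →L[ℝ] ℝ}
    (hB : ∀ v, v ≠ 0 → 0 < B v v) : B.IsInvertible := by
  have hinj : Function.Injective (B : V →ₗ[ℝ] V →L[ℝ] ℝ) := by
    rw [injective_iff_map_eq_zero]
    intro v hv
    by_contra h
    have h1 := hB v h
    have h2 : B v = 0 := hv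
    simp [h2] at h1
  have hdim : Module.finrank ℝ V = Module.finrank ℝ (V →L[ℝ] ℝ) := by
    rw [← (LinearMap.toContinuousLinearMap : (V →ₗ[ℝ] ℝ) ≃ₗ[ℝ] (V →L[ℝ] ℝ)).finrank_eq]
    exact Subspace.dual_finrank_eq.symm
  refine ⟨(LinearEquiv.ofInjectiveOfFinrankEq _ hinj hdim).toContinuousLinearEquiv, ?_⟩
  ext v w
  rfl

variable {p : ℕ} {B : V →L[ℝ] V →L[ℝ] ℝ} {e : Fin p → V}

theorem linearIndependent_of_orthonormal (he : ∀ i l, B (e i) (e l) = if i = l then 1 else 0) :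
    LinearIndependent ℝ e := by
  rw [Fintype.linearIndependent_iff]
  intro c hc i
  have := congrArg (fun v => B v (e i)) hc
  simpa [he] using this

/-- Decomposition of a vector into its component in the span of an orthonormal family and its
component orthogonal to that family. -/
theorem exists_add_orthogonal (he : ∀ i l, B (e i) (e l) = if i = l then 1 else 0) (v : V) :
    ∃ n ∈ Submodule.span ℝ (range e), ∃ w, (∀ i, B (e i) w = 0) ∧ n + w = v := by
  refine ⟨∑ i, B (e i) v • e i, Submodule.sum_mem _ fun i _ =>
    Submodule.smul_mem _ _ (Submodule.subset_span ⟨i, rfl⟩),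
    v - ∑ i, B (e i) v • e i, fun i => ?_, by abel⟩
  simp [he]

theorem apply_eq_zero_of_mem_span {x w : V} (hx : x ∈ Submodule.span ℝ (range e))
    (hw : ∀ i, B (e i) w = 0) : B x w = 0 := by
  induction hx using Submodule.span_induction with
  | mem x h => obtain ⟨i, rfl⟩ := h; exact hw i
  | zero => simp
  | add x y _ _ h1 h2 => simp [h1, h2]
  | smul c x _ h => simp [h]

theorem mem_span_iff_forall_orthogonal (hB : ∀ v, v ≠ 0 → 0 < B v v)
    (he : ∀ i l, B (e i) (e l) = if i = l then 1 else 0) (x : V) :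
    x ∈ Submodule.span ℝ (range e) ↔ ∀ w, (∀ i, B (e i) w = 0) → B x w = 0 := by
  refine ⟨fun hx w hw => apply_eq_zero_of_mem_span hx hw, fun h => ?_⟩
  obtain ⟨n, hn, w, hw, rfl⟩ := exists_add_orthogonal he x
  have h1 := h w hw
  rw [map_add, add_apply, apply_eq_zero_of_mem_span hn hw, zero_add] at h1
  have hw0 : w = 0 := by
    by_contra hne
    exact (hB w hne).ne' h1
  simpa [hw0] using hn

end InnerProducts

section FirstVariation

variable {V : Type*} [NormedAddCommGroup V] [NormedSpace ℝ V]

/-- The first variation of the leafwise volume in coordinates: for an orthonormal frame `e` of a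
metric `G` and `w` orthogonal to it, the exterior derivative of `G(e₁, ·) ∧ ⋯ ∧ G(e_p, ·)` on
`(w, e₁, …, e_p)` is `-∑ i, G(∇_{eᵢ} eᵢ, w)`, the Levi-Civita connection being expressed
through the derivative of `G`. -/
theorem extDeriv_wedge_metric {G : V → V →L[ℝ] V →L[ℝ] ℝ} {z : V} (hG : DifferentiableAt ℝ G z)
    (hsymm : ∀ u v, G z u v = G z v u) {p : ℕ} {e : Fin p → V → V}
    (he : ∀ i, DifferentiableAt ℝ (e i) z)
    (horth : ∀ᶠ y in 𝓝 z, ∀ i l, G y (e i y) (e l y) = if i = l then 1 else 0)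
    {w : V} (hw : ∀ i, G z (e i z) w = 0) :
    extDeriv (fun y => wedge fun i => G y (e i y)) z (Fin.cons w fun i => e i z) =
      -∑ i, (G z (fderiv ℝ (e i) z (e i z)) w + (fderiv ℝ G z (e i z) (e i z) w
        - (1 / 2 : ℝ) * fderiv ℝ G z w (e i z) (e i z))) := by
  have hθ (i : Fin p) : HasFDerivAt (fun y => G y (e i y))
      ((G z).comp (fderiv ℝ (e i) z) + (fderiv ℝ G z).flip (e i z)) z :=
    hG.hasFDerivAt.clm_apply (he i).hasFDerivAt
  -- differentiate `G(eᵢ, eᵢ) = 1` along `w`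
  have hnorm (i : Fin p) : G z (fderiv ℝ (e i) z w) (e i z)
      = -(1 / 2 : ℝ) * fderiv ℝ G z w (e i z) (e i z) := by
    have h1 := ((hθ i).clm_apply (he i).hasFDerivAt).fderiv
    have h2 : (fun y => G y (e i y) (e i y)) =ᶠ[𝓝 z] fun _ => (1 : ℝ) := by
      filter_upwards [horth] with y hy
      simp [hy]
    rw [h2.fderiv_eq] at h1
    have h3 := DFunLike.congr_fun h1 w
    simp at h3
    rw [hsymm (e i z)] at h3
    linarith
  rw [extDeriv_wedge_cons hθ horth.self_of_nhds hw, ← Finset.sum_neg_distrib]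
  refine Finset.sum_congr rfl fun i _ => ?_
  simp [hnorm]
  ring

end FirstVariation

section Tangency

variable {V F : Type*} [NormedAddCommGroup V] [NormedSpace ℝ V] [NormedAddCommGroup F]
  [NormedSpace ℝ F] [FiniteDimensional ℝ V] [FiniteDimensional ℝ F]

/-- A vector field `e` that is tangent to an immersed submanifold, parametrized by `f`, has
along the submanifold the derivative `D²f (a, a)` in its own direction `Df a`, up to a tangent
vector. -/
theorem fderiv_sub_hessian_mem_range {f : F → V} {z : F} (hf : ContDiffAt ℝ 2 f z)
    (hinj : Function.Injective (fderiv ℝ f z)) {e : V → V} (he : DifferentiableAt ℝ e (f z))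
    (htan : ∀ᶠ y in 𝓝 z, ∃ b, fderiv ℝ f y b = e (f y)) {a : F} (ha : fderiv ℝ f z a = e (f z)) :
    fderiv ℝ (fderiv ℝ f) z a a - fderiv ℝ e (f z) (e (f z)) ∈
      LinearMap.range (fderiv ℝ f z).toLinearMap := by
  have hf1 : DifferentiableAt ℝ f z := hf.differentiableAt (by norm_num)
  have hD : DifferentiableAt ℝ (fderiv ℝ f) z :=
    (hf.fderiv_right (m := 1) (by norm_num)).differentiableAt (by norm_num)
  obtain ⟨P, hP⟩ : ∃ P : V →L[ℝ] F, P.comp (fderiv ℝ f z) = ContinuousLinearMap.id ℝ F := by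
    obtain ⟨P, hP⟩ := LinearMap.exists_leftInverse_of_injective (fderiv ℝ f z).toLinearMap
      (LinearMap.ker_eq_bot.2 hinj)
    refine ⟨LinearMap.toContinuousLinearMap P, ?_⟩
    ext v
    exact DFunLike.congr_fun hP v
  -- `b y` is the vector with `Df (b y) = e (f y)`; the formula with the left inverse `P` shows that
  -- it depends differentiably on `y`, so that `Df (b y) = e (f y)` can be differentiated
  let b : F → F := fun y => Ring.inverse (P.comp (fderiv ℝ f y)) (P (e (f y)))
  have hPD : DifferentiableAt ℝ (fun y => P.comp (fderiv ℝ f y)) z :=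
    (differentiableAt_const P).clm_comp hD
  have hunit : IsUnit (P.comp (fderiv ℝ f z)) := by
    rw [hP]; exact isUnit_one
  have hef : DifferentiableAt ℝ (fun y => e (f y)) z := he.comp z hf1
  have hb : DifferentiableAt ℝ b z := by
    refine DifferentiableAt.clm_apply ?_ (P.differentiableAt.comp z hef)
    obtain ⟨u, hu⟩ := hunit
    have : DifferentiableAt ℝ Ring.inverse (P.comp (fderiv ℝ f z)) := by
      rw [← hu]
      exact differentiableAt_inverse u.isUnit
    exact this.comp z hPD
  have hev : ∀ᶠ y in 𝓝 z, fderiv ℝ f y (b y) = e (f y) := by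
    have h1 : ∀ᶠ y in 𝓝 z, IsUnit (P.comp (fderiv ℝ f y)) :=
      hPD.continuousAt.eventually (Units.isOpen.mem_nhds hunit)
    filter_upwards [h1, htan] with y hy ⟨c, hc⟩
    have : b y = c := by
      simp only [b]
      rw [← hc]
      exact DFunLike.congr_fun (Ring.inverse_mul_cancel _ hy) c
    rw [this, hc]
  have hbz : b z = a := hinj (hev.self_of_nhds.trans ha.symm)
  have h1 : fderiv ℝ (fun y => fderiv ℝ f y (b y)) z a = fderiv ℝ e (f z) (e (f z)) := by
    rw [Filter.EventuallyEq.fderiv_eq hev]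
    change fderiv ℝ (e ∘ f) z a = _
    rw [fderiv_comp z he hf1, ContinuousLinearMap.comp_apply, ha]
  rw [fderiv_clm_apply hD hb, hbz] at h1
  refine ⟨-fderiv ℝ b z a, ?_⟩
  rw [← h1]
  simp

end Tangency

section Frames

variable {V : Type*} [NormedAddCommGroup V] [NormedSpace ℝ V]

/-- A vector in the kernel of a smooth family of linear maps of constant rank extends to a smooth
local section of the kernels. -/
theorem exists_smooth_section_ker [FiniteDimensional ℝ V] {W : Type*}
    [NormedAddCommGroup W] [NormedSpace ℝ W] [FiniteDimensional ℝ W] {A : V → V →L[ℝ] W} {z : V}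
    (hA : ∀ᶠ y in 𝓝 z, ContDiffAt ℝ ∞ A y)
    (hrank : ∀ᶠ y in 𝓝 z, Module.finrank ℝ (LinearMap.ker (A y).toLinearMap) =
      Module.finrank ℝ (LinearMap.ker (A z).toLinearMap)) {v : V} (hv : A z v = 0) :
    ∃ e : V → V, e z = v ∧ ∀ᶠ y in 𝓝 z, ContDiffAt ℝ ∞ e y ∧ A y (e y) = 0 := by
  set N := LinearMap.ker (A z).toLinearMap with hN
  obtain ⟨π, hπ⟩ := N.subtype.exists_leftInverse_of_injective N.ker_subtype
  -- `Q` is a partial inverse of `A z`, so that `T y = π + Q ∘ A y` is the identity at `y = z`;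
  -- where `T y` is invertible it maps `ker (A y)` onto `N`.
  obtain ⟨Q, hQ⟩ : ∃ Q : W →ₗ[ℝ] V, Q ∘ₗ (A z).toLinearMap = LinearMap.id - N.subtype ∘ₗ π := by
    obtain ⟨R, hR⟩ := (N.liftQ (A z).toLinearMap le_rfl).exists_leftInverse_of_injective
      (N.ker_liftQ_eq_bot _ _ le_rfl)
    have hle : N ≤ LinearMap.ker (LinearMap.id - N.subtype ∘ₗ π) := by
      intro x hx
      have := DFunLike.congr_fun hπ ⟨x, hx⟩
      simp only [LinearMap.comp_apply, Submodule.subtype_apply, LinearMap.id_apply] at this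
      simp [this]
    refine ⟨N.liftQ _ hle ∘ₗ R, ?_⟩
    ext x
    have := DFunLike.congr_fun hR (N.mkQ x)
    simp only [LinearMap.comp_apply, Submodule.mkQ_apply, Submodule.liftQ_apply,
      LinearMap.id_apply] at this
    simp only [LinearMap.comp_apply, this, Submodule.liftQ_apply]
  let π' : V →L[ℝ] V := LinearMap.toContinuousLinearMap (N.subtype ∘ₗ π)
  let Q' : W →L[ℝ] V := LinearMap.toContinuousLinearMap Q
  let T : V → V →L[ℝ] V := fun y => π' + Q'.comp (A y)
  have hTz : T z = 1 := by
    ext x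
    have := DFunLike.congr_fun hQ x
    simp only [LinearMap.comp_apply] at this
    change ((π x : N) : V) + Q (A z x) = x
    erw [this]
    simp
  have hT : ∀ᶠ y in 𝓝 z, ContDiffAt ℝ ∞ T y := by
    filter_upwards [hA] with y hy
    exact contDiffAt_const.add (contDiffAt_const.clm_comp hy)
  have hunit : ∀ᶠ y in 𝓝 z, IsUnit (T y) :=
    hT.self_of_nhds.continuousAt.eventually
      (Units.isOpen.mem_nhds (show IsUnit (T z) from hTz ▸ isUnit_one))
  refine ⟨fun y => Ring.inverse (T y) v, by simp [hTz], ?_⟩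
  filter_upwards [hT, hunit, hrank] with y hTy hu hr
  constructor
  · obtain ⟨u, hu⟩ := hu
    have h1 : ContDiffAt ℝ ∞ Ring.inverse (T y) := hu ▸ contDiffAt_ringInverse ℝ u
    exact (h1.comp y hTy).clm_apply contDiffAt_const
  · let S : LinearMap.ker (A y).toLinearMap →ₗ[ℝ] N :=
      π ∘ₗ (LinearMap.ker (A y).toLinearMap).subtype
    have hS (x : LinearMap.ker (A y).toLinearMap) : T y x = S x := by
      have : A y x = 0 := x.2
      change ((π x : N) : V) + Q (A y x) = _
      rw [this]
      simp [S]
    have hinv (x : V) : Ring.inverse (T y) (T y x) = x :=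
      DFunLike.congr_fun (Ring.inverse_mul_cancel _ hu) x
    have hSinj : Function.Injective S := by
      intro a b hab
      apply Subtype.ext
      rw [← hinv a, hS, hab, ← hS, hinv]
    obtain ⟨x, hx⟩ := (LinearMap.injective_iff_surjective_of_finrank_eq_finrank hr).1 hSinj ⟨v, hv⟩
    have : T y x = v := by rw [hS, hx]
    rw [← this, hinv]
    exact x.2

/-- Gram–Schmidt orthonormalization of local sections of a family of subspaces, with respect to a
metric depending smoothly on the point, without changing values at a point where
they are already orthonormal. -/
theorem exists_smooth_orthonormal {G : V → V →L[ℝ] V →L[ℝ] ℝ} {z : V}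
    (hG : ∀ᶠ y in 𝓝 z, ContDiffAt ℝ ∞ G y) (hsymm : ∀ᶠ y in 𝓝 z, ∀ u v, G y u v = G y v u)
    (N : V → Submodule ℝ V) (p : ℕ) (e : Fin p → V → V)
    (he : ∀ i, ∀ᶠ y in 𝓝 z, ContDiffAt ℝ ∞ (e i) y ∧ e i y ∈ N y)
    (horth : ∀ i l, G z (e i z) (e l z) = if i = l then 1 else 0) :
    ∃ e' : Fin p → V → V, (∀ i, e' i z = e i z) ∧ ∀ᶠ y in 𝓝 z,
      (∀ i, ContDiffAt ℝ ∞ (e' i) y ∧ e' i y ∈ N y) ∧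
      ∀ i l, G y (e' i y) (e' l y) = if i = l then 1 else 0 := by
  induction p with
  | zero => exact ⟨e, fun i => i.elim0, .of_forall fun y => ⟨fun i => i.elim0, fun i => i.elim0⟩⟩
  | succ p ih =>
    obtain ⟨f, hfz, hf⟩ := ih (fun i => e i.castSucc) (fun i => he _) (fun i l => by
      simp [horth])
    let w : V → V := fun y => e (Fin.last p) y - ∑ i, G y (f i y) (e (Fin.last p) y) • f i y
    let q : V → ℝ := fun y => G y (w y) (w y)
    have hwz : w z = e (Fin.last p) z := by
      simp [w, hfz, horth, Fin.castSucc_ne_last]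
    have hqz : q z = 1 := by
      simp [q, hwz, horth]
    have hw : ∀ᶠ y in 𝓝 z, ContDiffAt ℝ ∞ w y ∧ w y ∈ N y := by
      filter_upwards [hf, he (Fin.last p), hG] with y ⟨hfy, _⟩ ⟨hey, heN⟩ hGy
      refine ⟨hey.sub (ContDiffAt.sum fun i _ =>
        ((hGy.clm_apply (hfy i).1).clm_apply hey).smul (hfy i).1),
        Submodule.sub_mem _ heN (Submodule.sum_mem _ fun i _ => Submodule.smul_mem _ _ (hfy i).2)⟩
    have hq : ∀ᶠ y in 𝓝 z, ContDiffAt ℝ ∞ q y := by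
      filter_upwards [hw, hG] with y hwy hGy
      exact (hGy.clm_apply hwy.1).clm_apply hwy.1
    have hqpos : ∀ᶠ y in 𝓝 z, 0 < q y :=
      hq.self_of_nhds.continuousAt.eventually (lt_mem_nhds (by rw [hqz]; norm_num))
    refine ⟨Fin.snoc (α := fun _ => V → V) f fun y => (√(q y))⁻¹ • w y, ?_, ?_⟩
    · intro i
      refine Fin.lastCases ?_ (fun i => ?_) i
      · simp [hqz, hwz]
      · simp [hfz]
    · filter_upwards [hf, hw, hq, hqpos, hsymm] with y ⟨hfy, hfo⟩ ⟨hwy, hwN⟩ hqy hpos hs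
      have hfw (i : Fin p) : G y (f i y) (w y) = 0 := by
        simp [w, hfo]
      refine ⟨fun i => ?_, fun i l => ?_⟩
      · refine Fin.lastCases ?_ (fun i => ?_) i
        · simp only [Fin.snoc_last]
          exact ⟨((hqy.sqrt hpos.ne').inv (Real.sqrt_pos.2 hpos).ne').smul hwy,
            Submodule.smul_mem _ _ hwN⟩
        · simpa using hfy i
      · refine Fin.lastCases ?_ (fun i => ?_) i <;> refine Fin.lastCases ?_ (fun l => ?_) l
        · simp only [Fin.snoc_last, map_smul, smul_apply, smul_eq_mul, if_true]
          change (√(q y))⁻¹ * ((√(q y))⁻¹ * q y) = 1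
          nth_rw 3 [← Real.mul_self_sqrt hpos.le]
          have := (Real.sqrt_pos.2 hpos).ne'
          field_simp
        · simp [hs (w y), hfw, (Fin.castSucc_ne_last l).symm]
        · simp [hfw, Fin.castSucc_ne_last]
        · simp [hfo]

end Frames

/-! ### Tensors and maps read in charts -/

section Charts

variable {E : Type*} [NormedAddCommGroup E] [NormedSpace ℝ E]
  {M : Type*} [TopologicalSpace M] [ChartedSpace E M]

/-- A property holding near `y` in `M` holds near the image of `y` in its preferred chart. -/
theorem eventually_extChartAt_symm {y : M} {P : M → Prop} (hP : ∀ᶠ x in 𝓝 y, P x) :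
    ∀ᶠ z in 𝓝 (extChartAt 𝓘(ℝ, E) y y), P ((extChartAt 𝓘(ℝ, E) y).symm z) :=
  (continuousAt_extChartAt_symm y).eventually (by rwa [extChartAt_to_inv])

theorem eventually_mem_target (y : M) :
    ∀ᶠ z in 𝓝 (extChartAt 𝓘(ℝ, E) y y), z ∈ (extChartAt 𝓘(ℝ, E) y).target :=
  extChartAt_target_mem_nhds y

variable {F : Type*} [NormedAddCommGroup F] [NormedSpace ℝ F]
  {L : Type*} [TopologicalSpace L] [ChartedSpace F L]

theorem mfderiv_eq_fderiv_writtenInExtChartAt {j : L → M} {s : L}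
    (hj : MDifferentiableAt 𝓘(ℝ, F) 𝓘(ℝ, E) j s) :
    mfderiv 𝓘(ℝ, F) 𝓘(ℝ, E) j s =
      fderiv ℝ (writtenInExtChartAt 𝓘(ℝ, F) 𝓘(ℝ, E) s j) (extChartAt 𝓘(ℝ, F) s s) := by
  rw [hj.mfderiv, ← fderivWithin_univ]
  simp
  rfl

variable [IsManifold 𝓘(ℝ, E) ∞ M]

/-- The isomorphism from the model space to the tangent space at `x` given by the
trivialization of the tangent bundle in the preferred chart at `y`. -/
def chartFrame (y x : M) : E →L[ℝ] TangentSpace 𝓘(ℝ, E) x :=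
  (trivializationAt E (TangentSpace 𝓘(ℝ, E)) y).symmL ℝ x

/-- The coordinates of tangent vectors at `x` in the preferred chart at `y`. -/
def chartCoord (y x : M) : TangentSpace 𝓘(ℝ, E) x →L[ℝ] E :=
  (trivializationAt E (TangentSpace 𝓘(ℝ, E)) y).continuousLinearMapAt ℝ x

/-- A vector field read in the preferred chart at `y`. -/
def chartField (e : ∀ x : M, TangentSpace 𝓘(ℝ, E) x) (y : M) (z : E) : E :=
  chartCoord y ((extChartAt 𝓘(ℝ, E) y).symm z) (e ((extChartAt 𝓘(ℝ, E) y).symm z))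

theorem mem_baseSet_of_mem_source {y x : M} (hx : x ∈ (extChartAt 𝓘(ℝ, E) y).source) :
    x ∈ (trivializationAt E (TangentSpace 𝓘(ℝ, E)) y).baseSet := by
  simpa using hx

theorem chartFrame_chartCoord {y x : M} (hx : x ∈ (extChartAt 𝓘(ℝ, E) y).source)
    (v : TangentSpace 𝓘(ℝ, E) x) : chartFrame y x (chartCoord y x v) = v :=
  Bundle.Trivialization.symmL_continuousLinearMapAt _ (mem_baseSet_of_mem_source hx) v

theorem chartCoord_chartFrame {y x : M} (hx : x ∈ (extChartAt 𝓘(ℝ, E) y).source)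
    (v : E) : chartCoord y x (chartFrame y x v) = v :=
  Bundle.Trivialization.continuousLinearMapAt_symmL _ (mem_baseSet_of_mem_source hx) v

theorem chartCoord_eq_mfderiv {y x : M} (hx : x ∈ (extChartAt 𝓘(ℝ, E) y).source) :
    chartCoord y x = mfderiv 𝓘(ℝ, E) 𝓘(ℝ, E) (extChartAt 𝓘(ℝ, E) y) x :=
  TangentBundle.continuousLinearMapAt_trivializationAt (by simpa using hx)

theorem chartDeriv_eq_id (y : M) : chartDeriv y = ContinuousLinearMap.id ℝ E :=
  mfderiv_extChartAt_self

theorem chartCoord_self (y : M) : chartCoord y y = ContinuousLinearMap.id ℝ E := by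
  rw [chartCoord_eq_mfderiv (mem_extChartAt_source y)]
  exact mfderiv_extChartAt_self

theorem chartSymmDeriv_eq {y : M} {z : E} (hz : z ∈ (extChartAt 𝓘(ℝ, E) y).target) :
    chartSymmDeriv y z = chartFrame y ((extChartAt 𝓘(ℝ, E) y).symm z) := by
  have hsrc : (extChartAt 𝓘(ℝ, E) y).symm z ∈ (chartAt E y).source := by
    simpa using (extChartAt 𝓘(ℝ, E) y).map_target hz
  have h1 := TangentBundle.symmL_trivializationAt (I := 𝓘(ℝ, E)) hsrc
  have h2 : ∀ z', z' = z → (mfderivWithin 𝓘(ℝ, E) 𝓘(ℝ, E) (extChartAt 𝓘(ℝ, E) y).symm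
      (range 𝓘(ℝ, E)) z' : E →L[ℝ] E) = chartSymmDeriv y z := by
    rintro _ rfl
    simp [chartSymmDeriv, mfderivWithin_univ]
    rfl
  exact (h2 _ ((extChartAt 𝓘(ℝ, E) y).right_inv hz)).symm.trans h1.symm

theorem chartField_eq {e : ∀ x : M, TangentSpace 𝓘(ℝ, E) x} {y x : M}
    (hx : x ∈ (extChartAt 𝓘(ℝ, E) y).source) :
    chartField e y (extChartAt 𝓘(ℝ, E) y x) = chartCoord y x (e x) := by
  rw [chartField, (extChartAt 𝓘(ℝ, E) y).left_inv hx]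

theorem chartField_self (e : ∀ x : M, TangentSpace 𝓘(ℝ, E) x) (y : M) :
    chartField e y (extChartAt 𝓘(ℝ, E) y y) = e y := by
  rw [chartField_eq (mem_extChartAt_source y), chartCoord_self]
  rfl

theorem chartBilin_apply
    (B : ∀ x : M, TangentSpace 𝓘(ℝ, E) x →L[ℝ] TangentSpace 𝓘(ℝ, E) x →L[ℝ] ℝ)
    {y x : M} (hx : x ∈ (extChartAt 𝓘(ℝ, E) y).source) (u v : E) :
    chartBilin B y (extChartAt 𝓘(ℝ, E) y x) u v = B x (chartFrame y x u) (chartFrame y x v) := by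
  rw [chartBilin, chartSymmDeriv_eq ((extChartAt 𝓘(ℝ, E) y).map_source hx),
    (extChartAt 𝓘(ℝ, E) y).left_inv hx]
  rfl

theorem chartFrame_self (y : M) : chartFrame y y = ContinuousLinearMap.id ℝ E := by
  ext v
  have := chartCoord_chartFrame (mem_extChartAt_source (I := 𝓘(ℝ, E)) y) v
  rwa [chartCoord_self] at this

theorem chartBilin_self
    (B : ∀ x : M, TangentSpace 𝓘(ℝ, E) x →L[ℝ] TangentSpace 𝓘(ℝ, E) x →L[ℝ] ℝ) (y : M) :
    chartBilin B y (extChartAt 𝓘(ℝ, E) y y) = B y := by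
  ext u v
  rw [chartBilin_apply B (mem_extChartAt_source y), chartFrame_self]
  rfl

/-- A function that is smooth on the domain of a chart is smooth when read in the chart. -/
theorem contDiffAt_comp_symm {y : M}
    {f : M → F} {z : E} (hz : z ∈ (extChartAt 𝓘(ℝ, E) y).target)
    (hf : ContMDiffAt 𝓘(ℝ, E) 𝓘(ℝ, F) ∞ f ((extChartAt 𝓘(ℝ, E) y).symm z)) :
    ContDiffAt ℝ ∞ (fun z => f ((extChartAt 𝓘(ℝ, E) y).symm z)) z := by
  rw [← contMDiffAt_iff_contDiffAt]
  refine ContMDiffAt.comp z hf ?_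
  exact (contMDiffOn_extChartAt_symm y).contMDiffAt ((isOpen_extChartAt_target y).mem_nhds hz)

/-- A vector field with smooth coordinates in the chart at `y` is smooth. -/
theorem contMDiffAt_chartFrame {y x : M} (hx : x ∈ (extChartAt 𝓘(ℝ, E) y).source) {u : M → E}
    (hu : ContMDiffAt 𝓘(ℝ, E) 𝓘(ℝ, E) ∞ u x) :
    ContMDiffAt 𝓘(ℝ, E) (𝓘(ℝ, E).prod 𝓘(ℝ, E)) ∞
      (fun x => (⟨x, chartFrame y x (u x)⟩ : TangentBundle 𝓘(ℝ, E) M)) x := by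
  have hb := mem_baseSet_of_mem_source hx
  refine (Bundle.Trivialization.contMDiffAt_section_iff
    (e := trivializationAt E (TangentSpace 𝓘(ℝ, E)) y) hb).2 ?_
  refine hu.congr_of_eventuallyEq ?_
  filter_upwards [(isOpen_extChartAt_source (I := 𝓘(ℝ, E)) y).mem_nhds hx] with x' hx'
  have h := chartCoord_chartFrame hx' (u x')
  rw [chartCoord, Bundle.Trivialization.continuousLinearMapAt_apply,
    Bundle.Trivialization.linearMapAt_apply, if_pos (mem_baseSet_of_mem_source hx')] at h
  exact h

theorem contDiffAt_chartField {e : ∀ x : M, TangentSpace 𝓘(ℝ, E) x} {y : M}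
    (he : ContMDiffAt 𝓘(ℝ, E) (𝓘(ℝ, E).prod 𝓘(ℝ, E)) ∞
      (fun x => (⟨x, e x⟩ : TangentBundle 𝓘(ℝ, E) M)) y) :
    ContDiffAt ℝ ∞ (chartField e y) (extChartAt 𝓘(ℝ, E) y y) := by
  have h1 := (Bundle.contMDiffAt_section y).1 he
  have h2 : ContMDiffAt 𝓘(ℝ, E) 𝓘(ℝ, E) ∞ (fun x => chartCoord y x (e x)) y := by
    refine h1.congr_of_eventuallyEq ?_
    filter_upwards [extChartAt_source_mem_nhds (I := 𝓘(ℝ, E)) y] with x' hx'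
    rw [chartCoord, Bundle.Trivialization.continuousLinearMapAt_apply,
      Bundle.Trivialization.linearMapAt_apply, if_pos (mem_baseSet_of_mem_source hx')]
  exact contDiffAt_comp_symm (mem_extChartAt_target (I := 𝓘(ℝ, E)) y) (by rwa [extChartAt_to_inv])

/-- A map between manifolds read in charts has as derivative the differential read in charts. -/
theorem fderiv_writtenInExtChartAt [IsManifold 𝓘(ℝ, F) ∞ L]
    {j : L → M} {s x : L} (hj : MDifferentiableAt 𝓘(ℝ, F) 𝓘(ℝ, E) j x)
    (hx : x ∈ (extChartAt 𝓘(ℝ, F) s).source) (hjx : j x ∈ (extChartAt 𝓘(ℝ, E) (j s)).source)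
    (b : TangentSpace 𝓘(ℝ, F) x) :
    fderiv ℝ (writtenInExtChartAt 𝓘(ℝ, F) 𝓘(ℝ, E) s j) (extChartAt 𝓘(ℝ, F) s x)
      (chartCoord s x b) = chartCoord (j s) (j x) (mfderiv 𝓘(ℝ, F) 𝓘(ℝ, E) j x b) := by
  set f := writtenInExtChartAt 𝓘(ℝ, F) 𝓘(ℝ, E) s j with hf
  have hφ := mdifferentiableAt_extChartAt (I := 𝓘(ℝ, E)) (x := j s) (y := j x) (by simpa using hjx)
  have hχ := mdifferentiableAt_extChartAt (I := 𝓘(ℝ, F)) (x := s) (y := x) (by simpa using hx)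
  have hχs : MDifferentiableAt 𝓘(ℝ, F) 𝓘(ℝ, F) (extChartAt 𝓘(ℝ, F) s).symm
      (extChartAt 𝓘(ℝ, F) s x) :=
    (mdifferentiableOn_extChartAt_symm _ ((extChartAt 𝓘(ℝ, F) s).map_source hx)).mdifferentiableAt
      ((isOpen_extChartAt_target s).mem_nhds ((extChartAt 𝓘(ℝ, F) s).map_source hx))
  have hfd : MDifferentiableAt 𝓘(ℝ, F) 𝓘(ℝ, E) f (extChartAt 𝓘(ℝ, F) s x) := by
    have hinv := (extChartAt 𝓘(ℝ, F) s).left_inv hx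
    refine MDifferentiableAt.comp (I' := 𝓘(ℝ, F)) (g := extChartAt 𝓘(ℝ, E) (j s) ∘ j) _ ?_ hχs
    rw [hinv]
    exact hφ.comp x hj
  have hev : f ∘ extChartAt 𝓘(ℝ, F) s =ᶠ[𝓝 x] extChartAt 𝓘(ℝ, E) (j s) ∘ j := by
    filter_upwards [(isOpen_extChartAt_source (I := 𝓘(ℝ, F)) s).mem_nhds hx] with x' hx'
    simp only [hf, writtenInExtChartAt, Function.comp_apply]
    rw [(extChartAt 𝓘(ℝ, F) s).left_inv hx']
  have h := hev.mfderiv_eq (I := 𝓘(ℝ, F)) (I' := 𝓘(ℝ, E))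
  rw [mfderiv_comp x hfd hχ, mfderiv_comp x hφ hj, mfderiv_eq_fderiv,
    ← chartCoord_eq_mfderiv hx, ← chartCoord_eq_mfderiv hjx] at h
  exact DFunLike.congr_fun h b

theorem mextDeriv_apply {p : ℕ} (ν : ∀ x : M, TangentSpace 𝓘(ℝ, E) x [⋀^Fin p]→L[ℝ] ℝ) (y : M)
    (v : Fin (p + 1) → E) :
    mextDeriv ν y v = extDeriv (chartForm ν y) (extChartAt 𝓘(ℝ, E) y y) v := by
  rw [mextDeriv, chartDeriv_eq_id]
  rfl

theorem chartDeriv_inverse (y : M) : (chartDeriv y).inverse = ContinuousLinearMap.id ℝ E := by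
  rw [chartDeriv_eq_id]
  exact ContinuousLinearMap.inverse_id

variable [IsManifold 𝓘(ℝ, F) ∞ L]

/-- The second covariant derivative of `j` in coordinates. The differentials of the preferred charts
at their base points are identities. -/
theorem covHessian_eq
    (g : ∀ x : M, TangentSpace 𝓘(ℝ, E) x →L[ℝ] TangentSpace 𝓘(ℝ, E) x →L[ℝ] ℝ)
    (j : L → M) (s : L) (a b : TangentSpace 𝓘(ℝ, F) s) :
    covHessian g j s a b =
      fderiv ℝ (fderiv ℝ (writtenInExtChartAt 𝓘(ℝ, F) 𝓘(ℝ, E) s j)) (extChartAt 𝓘(ℝ, F) s s) a b +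
      christoffel g (j s)
        (fderiv ℝ (writtenInExtChartAt 𝓘(ℝ, F) 𝓘(ℝ, E) s j) (extChartAt 𝓘(ℝ, F) s s) a)
        (fderiv ℝ (writtenInExtChartAt 𝓘(ℝ, F) 𝓘(ℝ, E) s j) (extChartAt 𝓘(ℝ, F) s s) b) := by
  simp only [covHessian, chartDeriv_inverse]
  simp only [chartDeriv_eq_id]
  rfl

end Charts

/-! ### The restricted symplectic form and the induced metric -/

section Smoothness

variable {E : Type*} [NormedAddCommGroup E] [NormedSpace ℝ E] [FiniteDimensional ℝ E]
  {M : Type*} [TopologicalSpace M] [ChartedSpace E M] [IsManifold 𝓘(ℝ, E) ∞ M]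

/-- A field of bilinear forms is smooth in a chart if its values on the coordinate vector fields
are smooth functions. -/
theorem contDiffAt_chartBilin
    {B : ∀ x : M, TangentSpace 𝓘(ℝ, E) x →L[ℝ] TangentSpace 𝓘(ℝ, E) x →L[ℝ] ℝ} {y : M}
    (hB : ∀ x ∈ (extChartAt 𝓘(ℝ, E) y).source, ∀ u v : E, ContMDiffAt 𝓘(ℝ, E) 𝓘(ℝ) ∞
      (fun x => B x (chartFrame y x u) (chartFrame y x v)) x)
    {z : E} (hz : z ∈ (extChartAt 𝓘(ℝ, E) y).target) :
    ContDiffAt ℝ ∞ (chartBilin B y) z := by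
  have ho := isOpen_extChartAt_target (I := 𝓘(ℝ, E)) y
  suffices h : ContDiffOn ℝ ∞ (chartBilin B y) (extChartAt 𝓘(ℝ, E) y).target from
    h.contDiffAt (ho.mem_nhds hz)
  rw [contDiffOn_clm_apply]
  intro u
  rw [contDiffOn_clm_apply]
  intro v z hz
  have h := contDiffAt_comp_symm hz (hB _ ((extChartAt 𝓘(ℝ, E) y).map_target hz) u v)
  refine (h.congr_of_eventuallyEq ?_).contDiffWithinAt
  filter_upwards [ho.mem_nhds hz] with z' hz'
  rw [← chartBilin_apply B ((extChartAt 𝓘(ℝ, E) y).map_target hz'),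
    (extChartAt 𝓘(ℝ, E) y).right_inv hz']

variable {X : Type*} {E₀ : Type*} [NormedAddCommGroup E₀] [NormedSpace ℝ E₀]
  [FiniteDimensional ℝ E₀] [TopologicalSpace X] [ChartedSpace E₀ X] [IsManifold 𝓘(ℝ, E₀) ∞ X]

/-- The pullback `ι^* ω` of the symplectic form, whose kernel is the null distribution. -/
def inducedForm (K : AlmostKahlerStructure E₀ X) (ι : M → X) (y : M) :
    TangentSpace 𝓘(ℝ, E) y →L[ℝ] TangentSpace 𝓘(ℝ, E) y →L[ℝ] ℝ :=
  pullbackBilin (mfderiv 𝓘(ℝ, E) 𝓘(ℝ, E₀) ι y) (K.form (ι y))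

theorem contMDiffAt_mfderiv_chartFrame {E : Type*} [NormedAddCommGroup E] [NormedSpace ℝ E]
    {M : Type*} [TopologicalSpace M] [ChartedSpace E M] [IsManifold 𝓘(ℝ, E) ∞ M]
    {X : Type*} {E₀ : Type*} [NormedAddCommGroup E₀] [NormedSpace ℝ E₀]
    [TopologicalSpace X] [ChartedSpace E₀ X] [IsManifold 𝓘(ℝ, E₀) ∞ X]
    {ι : M → X} (hι : ContMDiff 𝓘(ℝ, E) 𝓘(ℝ, E₀) ∞ ι)
    {y x : M} (hx : x ∈ (extChartAt 𝓘(ℝ, E) y).source) (u : E) :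
    ContMDiffAt 𝓘(ℝ, E) (𝓘(ℝ, E₀).prod 𝓘(ℝ, E₀)) ∞
      (fun x => (⟨ι x, mfderiv 𝓘(ℝ, E) 𝓘(ℝ, E₀) ι x (chartFrame y x u)⟩ :
        TangentBundle 𝓘(ℝ, E₀) X)) x :=
  ((hι.contMDiff_tangentMap (m := ∞) (by simp)).contMDiffAt).comp x
    (contMDiffAt_chartFrame hx (contMDiffAt_const (c := u)))

theorem contDiffAt_chartBilin_inducedForm (K : AlmostKahlerStructure E₀ X) {ι : M → X}
    (hι : ContMDiff 𝓘(ℝ, E) 𝓘(ℝ, E₀) ∞ ι) {y : M} {z : E}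
    (hz : z ∈ (extChartAt 𝓘(ℝ, E) y).target) :
    ContDiffAt ℝ ∞ (chartBilin (inducedForm K ι) y) z := by
  refine contDiffAt_chartBilin (fun x hx u v => ?_) hz
  have : ContMDiffAt 𝓘(ℝ, E) (𝓘(ℝ, E₀).prod 𝓘(ℝ)) ∞
      (fun x => Bundle.TotalSpace.mk' ℝ (E := Bundle.Trivial X ℝ) (ι x)
        (inducedForm K ι x (chartFrame y x u) (chartFrame y x v))) x := by
    apply ContMDiffAt.clm_bundle_apply₂ (F₁ := E₀) (F₂ := E₀)
      (E₁ := fun x : X => TangentSpace 𝓘(ℝ, E₀) x) (E₂ := fun x : X => TangentSpace 𝓘(ℝ, E₀) x)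
      (E₃ := Bundle.Trivial X ℝ)
      (v := fun x => mfderiv 𝓘(ℝ, E) 𝓘(ℝ, E₀) ι x (chartFrame y x u))
      (w := fun x => mfderiv 𝓘(ℝ, E) 𝓘(ℝ, E₀) ι x (chartFrame y x v))
    · exact ContMDiffAt.comp x K.smooth_form.contMDiffAt hι.contMDiffAt
    · exact contMDiffAt_mfderiv_chartFrame hι hx u
    · exact contMDiffAt_mfderiv_chartFrame hι hx v
  exact (Bundle.contMDiffAt_totalSpace.1 this).2

theorem contDiffAt_chartBilin_inducedMetric (K : AlmostKahlerStructure E₀ X) {ι : M → X}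
    (hι : ContMDiff 𝓘(ℝ, E) 𝓘(ℝ, E₀) ∞ ι) {y : M} {z : E}
    (hz : z ∈ (extChartAt 𝓘(ℝ, E) y).target) :
    ContDiffAt ℝ ∞ (chartBilin (inducedMetric K ι) y) z := by
  refine contDiffAt_chartBilin (fun x hx u v => ?_) hz
  have : ContMDiffAt 𝓘(ℝ, E) (𝓘(ℝ, E₀).prod 𝓘(ℝ)) ∞
      (fun x => Bundle.TotalSpace.mk' ℝ (E := Bundle.Trivial X ℝ) (ι x)
        (inducedMetric K ι x (chartFrame y x u) (chartFrame y x v))) x := by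
    apply ContMDiffAt.clm_bundle_apply₂ (F₁ := E₀) (F₂ := E₀)
      (E₁ := fun x : X => TangentSpace 𝓘(ℝ, E₀) x) (E₂ := fun x : X => TangentSpace 𝓘(ℝ, E₀) x)
      (E₃ := Bundle.Trivial X ℝ)
      (v := fun x => mfderiv 𝓘(ℝ, E) 𝓘(ℝ, E₀) ι x (chartFrame y x u))
      (w := fun x => K.J (ι x) (mfderiv 𝓘(ℝ, E) 𝓘(ℝ, E₀) ι x (chartFrame y x v)))
    · exact ContMDiffAt.comp x K.smooth_form.contMDiffAt hι.contMDiffAt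
    · exact contMDiffAt_mfderiv_chartFrame hι hx u
    · apply ContMDiffAt.clm_bundle_apply (F₁ := E₀) (F₂ := E₀)
        (E₁ := fun x : X => TangentSpace 𝓘(ℝ, E₀) x) (E₂ := fun x : X => TangentSpace 𝓘(ℝ, E₀) x)
      · exact ContMDiffAt.comp x K.smooth_J.contMDiffAt hι.contMDiffAt
      · exact contMDiffAt_mfderiv_chartFrame hι hx v
  exact (Bundle.contMDiffAt_totalSpace.1 this).2

end Smoothness

section LinearAlgebra

variable {E : Type*} [NormedAddCommGroup E] [NormedSpace ℝ E]
  {M : Type*} [TopologicalSpace M] [ChartedSpace E M]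
  {X : Type*} {E₀ : Type*} [NormedAddCommGroup E₀] [NormedSpace ℝ E₀]
  [FiniteDimensional ℝ E₀] [TopologicalSpace X] [ChartedSpace E₀ X] [IsManifold 𝓘(ℝ, E₀) ∞ X]
  {K : AlmostKahlerStructure E₀ X} {ι : M → X}

theorem AlmostKahlerStructure.form_swap (K : AlmostKahlerStructure E₀ X) (x : X)
    (v w : TangentSpace 𝓘(ℝ, E₀) x) : K.form x v w = -K.form x w v := by
  have h := K.alternating x (v + w)
  simp only [map_add, add_apply, K.alternating] at h
  linarith

theorem inducedMetric_symm (K : AlmostKahlerStructure E₀ X) (ι : M → X) (y : M)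
    (u v : TangentSpace 𝓘(ℝ, E) y) : inducedMetric K ι y u v = inducedMetric K ι y v u := by
  simp only [inducedMetric, pullbackBilin_apply, AlmostKahlerStructure.metric_apply]
  rw [← K.form_J, K.J_sq, map_neg, K.form_swap, neg_neg]

theorem inducedMetric_pos (hι : IsCoisotropicSubmanifold (E' := E) K ι) (y : M)
    (v : TangentSpace 𝓘(ℝ, E) y) (hv : v ≠ 0) : 0 < inducedMetric K ι y v v := by
  simp only [inducedMetric, pullbackBilin_apply, AlmostKahlerStructure.metric_apply]
  refine K.form_pos _ _ fun h => hv (hι.immersion y ?_)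
  rw [h, map_zero]

/-- The null distribution of a coisotropic submanifold has constant rank, equal to the codimension
of the submanifold: it is the full symplectic orthogonal complement of the tangent space, whose
dimension is known because `ω` is nondegenerate. -/
theorem finrank_nullDistribution (hι : IsCoisotropicSubmanifold (E' := E) K ι) (y : M) :
    Module.finrank ℝ (nullDistribution (E' := E) K ι y) =
      Module.finrank ℝ E₀ - Module.finrank ℝ E := by
  let Ω : LinearMap.BilinForm ℝ (TangentSpace 𝓘(ℝ, E₀) (ι y)) :=
    LinearMap.mk₂ ℝ (fun v w => K.form (ι y) v w) (by simp) (by simp) (by simp) (by simp)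
  have hΩ (v w) : Ω v w = K.form (ι y) v w := rfl
  have hrefl : Ω.IsRefl := fun v w h => by
    rw [hΩ, K.form_swap, ← hΩ, h, neg_zero]
  have hnd : Ω.Nondegenerate := by
    constructor
    · intro v h
      by_contra hv
      exact (K.form_pos _ v hv).ne' (h _)
    · intro v h
      by_contra hv
      refine (K.form_pos _ v hv).ne' ?_
      rw [K.form_swap, ← hΩ, h, neg_zero]
  let D := (mfderiv 𝓘(ℝ, E) 𝓘(ℝ, E₀) ι y).toLinearMap
  have hD : Function.Injective D := hι.immersion y
  have hmap : (nullDistribution (E' := E) K ι y).map D = Ω.orthogonal (LinearMap.range D) := by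
    ext v
    simp only [Submodule.mem_map, LinearMap.BilinForm.mem_orthogonal_iff, LinearMap.mem_range,
      forall_exists_index, forall_apply_eq_imp_iff]
    constructor
    · rintro ⟨u, hu, rfl⟩ w
      rw [hΩ, K.form_swap]
      have h : inducedForm K ι y u = 0 := hu
      have h' := DFunLike.congr_fun h w
      change -(inducedForm K ι y u w) = 0
      rw [h']
      simp
    · intro h
      have h' : ∀ u, K.form (ι y) v (D u) = 0 := fun u => by
        rw [K.form_swap, ← hΩ, h, neg_zero]
      obtain ⟨u, hu⟩ := hι.coisotropic y v h'
      refine ⟨u, ?_, hu⟩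
      change inducedForm K ι y u = 0
      ext w
      change K.form (ι y) (D u) (D w) = 0
      rw [← h' w, ← hu]
      rfl
  have hX : Module.finrank ℝ (TangentSpace 𝓘(ℝ, E₀) (ι y)) = Module.finrank ℝ E₀ := rfl
  have hY : Module.finrank ℝ (TangentSpace 𝓘(ℝ, E) y) = Module.finrank ℝ E := rfl
  rw [(Submodule.equivMapOfInjective D hD _).finrank_eq, hmap,
    LinearMap.BilinForm.finrank_orthogonal hnd, LinearMap.finrank_range_of_inj hD, hX, hY]

end LinearAlgebra

/-! ### Adapted frames, the leafwise volume form and the mean curvature -/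

section Frames

variable {E : Type*} [NormedAddCommGroup E] [NormedSpace ℝ E]
  {Y : Type*} [TopologicalSpace Y] [ChartedSpace E Y]
  {X : Type*} {E₀ : Type*} [NormedAddCommGroup E₀] [NormedSpace ℝ E₀]
  [FiniteDimensional ℝ E₀] [TopologicalSpace X] [ChartedSpace E₀ X] [IsManifold 𝓘(ℝ, E₀) ∞ X]
  {K : AlmostKahlerStructure E₀ X} {ι : Y → X}

theorem mem_nullDistribution_iff {x : Y} (v : TangentSpace 𝓘(ℝ, E) x) :
    v ∈ nullDistribution (E' := E) K ι x ↔ inducedForm K ι x v = 0 := Iff.rfl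

theorem chartBilin_inducedMetric_symm (K : AlmostKahlerStructure E₀ X) (ι : Y → X) (y : Y)
    (z u v : E) : chartBilin (inducedMetric K ι) y z u v =
      chartBilin (inducedMetric K ι) y z v u := by
  rw [chartBilin, pullbackBilin_apply, pullbackBilin_apply, inducedMetric_symm]

variable [IsManifold 𝓘(ℝ, E) ∞ Y]

/-- In a chart, the null distribution is the kernel of the restricted symplectic form. -/
theorem chartFrame_mem_nullDistribution_iff {y x : Y} (hx : x ∈ (extChartAt 𝓘(ℝ, E) y).source)
    (u : E) : chartFrame y x u ∈ nullDistribution (E' := E) K ι x ↔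
      chartBilin (inducedForm K ι) y (extChartAt 𝓘(ℝ, E) y x) u = 0 := by
  rw [mem_nullDistribution_iff]
  constructor
  · intro h
    ext v
    rw [chartBilin_apply _ hx, h]
    rfl
  · intro h
    ext v
    rw [← chartFrame_chartCoord hx v, ← chartBilin_apply _ hx, h]
    rfl

theorem finrank_ker_chartBilin_inducedForm (hι : IsCoisotropicSubmanifold (E' := E) K ι) {y : Y}
    {z : E} (hz : z ∈ (extChartAt 𝓘(ℝ, E) y).target) :
    Module.finrank ℝ (LinearMap.ker (chartBilin (inducedForm K ι) y z).toLinearMap) =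
      Module.finrank ℝ E₀ - Module.finrank ℝ E := by
  set x := (extChartAt 𝓘(ℝ, E) y).symm z with hxdef
  have hx : x ∈ (extChartAt 𝓘(ℝ, E) y).source := (extChartAt 𝓘(ℝ, E) y).map_target hz
  have hxz : extChartAt 𝓘(ℝ, E) y x = z := (extChartAt 𝓘(ℝ, E) y).right_inv hz
  have hinj : Function.Injective (chartFrame y x).toLinearMap := fun u v h => by
    rw [← chartCoord_chartFrame hx u, ← chartCoord_chartFrame hx v]
    exact congrArg _ h
  have hmap : (LinearMap.ker (chartBilin (inducedForm K ι) y z).toLinearMap).map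
      (chartFrame y x).toLinearMap = nullDistribution (E' := E) K ι x := by
    ext v
    rw [Submodule.mem_map, ← hxz]
    constructor
    · rintro ⟨u, hu, rfl⟩
      exact (chartFrame_mem_nullDistribution_iff hx u).2 hu
    · intro hv
      rw [← chartFrame_chartCoord hx v] at hv
      exact ⟨chartCoord y x v, (chartFrame_mem_nullDistribution_iff hx _).1 hv,
        chartFrame_chartCoord hx v⟩
  rw [(Submodule.equivMapOfInjective _ hinj _).finrank_eq, hmap, finrank_nullDistribution hι]

variable [FiniteDimensional ℝ E]

/-- An orthonormal basis of the null distribution at a point extends to a local adapted frame. -/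
theorem exists_isLeafFrame (hι : IsCoisotropicSubmanifold (E' := E) K ι) {p : ℕ}
    (hp : Module.finrank ℝ E₀ - Module.finrank ℝ E = p) (y : Y)
    (a : Fin p → TangentSpace 𝓘(ℝ, E) y) (ha : ∀ i, a i ∈ nullDistribution (E' := E) K ι y)
    (horth : ∀ i l, inducedMetric K ι y (a i) (a l) = if i = l then 1 else 0) :
    ∃ (U : Set Y) (e : Fin p → ∀ x : Y, TangentSpace 𝓘(ℝ, E) x),
      IsLeafFrame (E' := E) K ι U e ∧ y ∈ U ∧ ∀ i, e i y = a i := by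
  set φ := extChartAt 𝓘(ℝ, E) y with hφ
  have hys : y ∈ φ.source := mem_extChartAt_source y
  have htgt := eventually_mem_target (E := E) y
  have hker : ∀ i, ∃ e : E → E, e (φ y) = a i ∧
      ∀ᶠ z in 𝓝 (φ y), ContDiffAt ℝ ∞ e z ∧ chartBilin (inducedForm K ι) y z (e z) = 0 := by
    intro i
    refine exists_smooth_section_ker (V := E)
      (A := chartBilin (inducedForm K ι) y) ?_ ?_ ?_
    · filter_upwards [htgt] with z hz using contDiffAt_chartBilin_inducedForm K hι.smooth hz
    · filter_upwards [htgt] with z hz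
      rw [finrank_ker_chartBilin_inducedForm hι hz,
        finrank_ker_chartBilin_inducedForm hι (mem_extChartAt_target (I := 𝓘(ℝ, E)) y)]
    · rw [chartBilin_self]
      exact ha i
  choose f hf hf' using hker
  have hsymm : ∀ᶠ z in 𝓝 (φ y), ∀ u v, chartBilin (inducedMetric K ι) y z u v =
      chartBilin (inducedMetric K ι) y z v u :=
    .of_forall fun z u v => chartBilin_inducedMetric_symm K ι y z u v
  obtain ⟨g, hg, hg'⟩ := exists_smooth_orthonormal (G := chartBilin (inducedMetric K ι) y)
    (htgt.mono fun z hz => contDiffAt_chartBilin_inducedMetric K hι.smooth hz) hsymm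
    (fun z => LinearMap.ker (chartBilin (inducedForm K ι) y z).toLinearMap) p f hf'
    (fun i l => by rw [hf, hf, chartBilin_self]; exact horth i l)
  obtain ⟨O, hO, hOo, hyO⟩ := eventually_nhds_iff.1 hg'
  have hmem {x : Y} (hx : x ∈ φ.source ∩ φ ⁻¹' O) (i : Fin p) :
      chartFrame y x (g i (φ x)) ∈ nullDistribution (E' := E) K ι x :=
    (chartFrame_mem_nullDistribution_iff hx.1 _).2 ((hO _ hx.2).1 i).2
  have hon {x : Y} (hx : x ∈ φ.source ∩ φ ⁻¹' O) (i l : Fin p) : inducedMetric K ι x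
      (chartFrame y x (g i (φ x))) (chartFrame y x (g l (φ x))) = if i = l then 1 else 0 := by
    rw [← chartBilin_apply _ hx.1]
    exact (hO _ hx.2).2 i l
  refine ⟨φ.source ∩ φ ⁻¹' O, fun i x => chartFrame y x (g i (φ x)), ⟨?_, ?_, ?_, ?_⟩,
    ⟨hys, hyO⟩, fun i => ?_⟩
  · exact (continuousOn_extChartAt y).isOpen_inter_preimage (isOpen_extChartAt_source y) hOo
  · intro i x hx
    refine (contMDiffAt_chartFrame hx.1 ?_).contMDiffWithinAt
    exact ((hO _ hx.2).1 i).1.contMDiffAt.comp x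
      (contMDiffAt_extChartAt' (by simpa [hφ] using hx.1))
  · intro x hx
    refine Submodule.eq_of_le_of_finrank_eq ?_ ?_
    · rw [Submodule.span_le]
      rintro _ ⟨i, rfl⟩
      exact hmem hx i
    · rw [finrank_nullDistribution hι, hp]
      have := finrank_span_eq_card (R := ℝ) (linearIndependent_of_orthonormal (V := E) (hon hx))
      rw [Fintype.card_fin] at this
      exact this
  · intro x hx i l
    exact hon hx i l
  · change chartFrame y y (g i (φ y)) = a i
    rw [chartFrame_self, hg, hf]
    rfl

end Frames

section MeanCurvature

variable {E : Type*} [NormedAddCommGroup E] [NormedSpace ℝ E]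
  {Y : Type*} [TopologicalSpace Y] [ChartedSpace E Y] [IsManifold 𝓘(ℝ, E) ∞ Y]
  {X : Type*} {E₀ : Type*} [NormedAddCommGroup E₀] [NormedSpace ℝ E₀]
  [FiniteDimensional ℝ E₀] [TopologicalSpace X] [ChartedSpace E₀ X] [IsManifold 𝓘(ℝ, E₀) ∞ X]
  {K : AlmostKahlerStructure E₀ X} {ι : Y → X}

/-- In a chart, the leafwise volume form is given by the same formula in terms of the metric and the
frame read in the chart. -/
theorem chartForm_leafVolumeForm {p : ℕ} (K : AlmostKahlerStructure E₀ X) (ι : Y → X)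
    (e : Fin p → ∀ y : Y, TangentSpace 𝓘(ℝ, E) y) {y : Y} {z : E}
    (hz : z ∈ (extChartAt 𝓘(ℝ, E) y).target) :
    chartForm (leafVolumeForm K ι e) y z =
      wedge fun i => chartBilin (inducedMetric K ι) y z (chartField (e i) y z) := by
  have hx := (extChartAt 𝓘(ℝ, E) y).map_target hz
  ext v
  rw [wedge_apply, chartForm, ContinuousAlternatingMap.compContinuousLinearMap_apply,
    leafVolumeForm, wedge_apply]
  congr 1
  ext i l
  simp only [Matrix.of_apply, chartBilin, chartSymmDeriv_eq hz, pullbackBilin_apply,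
    chartField, chartFrame_chartCoord hx, Function.comp_apply]

variable [FiniteDimensional ℝ E]

/-- The defining property of the Christoffel symbols, on the diagonal. -/
theorem metric_christoffel_self
    {g : ∀ x : Y, TangentSpace 𝓘(ℝ, E) x →L[ℝ] TangentSpace 𝓘(ℝ, E) x →L[ℝ] ℝ} {y : Y}
    (hg : ∀ v, v ≠ 0 → 0 < g y v v) (a c : E) :
    chartBilin g y (extChartAt 𝓘(ℝ, E) y y) (christoffel g y a a) c =
      fderiv ℝ (chartBilin g y) (extChartAt 𝓘(ℝ, E) y y) a a c -
      (1 / 2 : ℝ) * fderiv ℝ (chartBilin g y) (extChartAt 𝓘(ℝ, E) y y) c a a := by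
  have hinv : (chartBilin g y (extChartAt 𝓘(ℝ, E) y y)).IsInvertible := by
    rw [chartBilin_self]
    exact isInvertible_of_posDef (V := E) hg
  simp only [christoffel]
  rw [hinv.self_apply_inverse]
  simp
  ring

/-- The covariant derivative `∇_e e` at `y` of a vector field `e` in its own direction, for the
Levi-Civita connection of `g`, computed in the preferred chart at `y`. -/
def covDerivSelf (g : ∀ x : Y, TangentSpace 𝓘(ℝ, E) x →L[ℝ] TangentSpace 𝓘(ℝ, E) x →L[ℝ] ℝ)
    (e : ∀ x : Y, TangentSpace 𝓘(ℝ, E) x) (y : Y) : TangentSpace 𝓘(ℝ, E) y :=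
  fderiv ℝ (chartField e y) (extChartAt 𝓘(ℝ, E) y y) (e y) + christoffel g y (e y) (e y)

/-- For `w` orthogonal to the leaves, `dν (w, e₁, …, e_p)` is, up to sign, the component of
`∑ i, ∇_{eᵢ} eᵢ` along `w`. -/
theorem mextDeriv_leafVolumeForm_cons (hι : IsCoisotropicSubmanifold (E' := E) K ι) {p : ℕ}
    {U : Set Y} {e : Fin p → ∀ y : Y, TangentSpace 𝓘(ℝ, E) y}
    (he : IsLeafFrame (E' := E) K ι U e) {y : Y} (hy : y ∈ U) {w : TangentSpace 𝓘(ℝ, E) y}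
    (hw : ∀ i, inducedMetric K ι y (e i y) w = 0) :
    mextDeriv (leafVolumeForm K ι e) y (Fin.cons w fun i => e i y) =
      -inducedMetric K ι y (∑ i, covDerivSelf (inducedMetric K ι) (e i) y) w := by
  have hU : U ∈ 𝓝 y := he.isOpen.mem_nhds hy
  have htgt := eventually_mem_target (E := E) y
  have hev : chartForm (leafVolumeForm K ι e) y =ᶠ[𝓝 (extChartAt 𝓘(ℝ, E) y y)] fun z =>
      wedge fun i => chartBilin (inducedMetric K ι) y z (chartField (e i) y z) := by
    filter_upwards [htgt] with z hz using chartForm_leafVolumeForm K ι e hz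
  have hG : DifferentiableAt ℝ (chartBilin (inducedMetric (E' := E) K ι) y)
      (extChartAt 𝓘(ℝ, E) y y) :=
    (contDiffAt_chartBilin_inducedMetric K hι.smooth (mem_extChartAt_target (I := 𝓘(ℝ, E)) y)).differentiableAt
      (by simp)
  have hsymm (u v : E) : chartBilin (inducedMetric K ι) y (extChartAt 𝓘(ℝ, E) y y) u v =
      chartBilin (inducedMetric K ι) y (extChartAt 𝓘(ℝ, E) y y) v u :=
    chartBilin_inducedMetric_symm K ι y _ u v
  have hfield (i : Fin p) : DifferentiableAt ℝ (chartField (e i) y) (extChartAt 𝓘(ℝ, E) y y) :=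
    (contDiffAt_chartField ((he.smooth i).contMDiffAt hU)).differentiableAt (by simp)
  have horth : ∀ᶠ z in 𝓝 (extChartAt 𝓘(ℝ, E) y y), ∀ i l,
      chartBilin (inducedMetric K ι) y z (chartField (e i) y z) (chartField (e l) y z) =
        if i = l then 1 else 0 := by
    filter_upwards [htgt, eventually_extChartAt_symm (E := E) hU] with z hz hzU i l
    have hx := (extChartAt 𝓘(ℝ, E) y).map_target hz
    rw [← he.orthonormal _ hzU i l]
    simp only [chartBilin, chartSymmDeriv_eq hz, pullbackBilin_apply, chartField,
      chartFrame_chartCoord hx]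
  have h := extDeriv_wedge_metric hG hsymm hfield horth (w := w) (fun i => by
    rw [chartBilin_self, chartField_self]; exact hw i)
  simp only [chartField_self] at h
  refine (mextDeriv_apply (leafVolumeForm K ι e) y (Fin.cons w fun i => e i y)).trans ?_
  rw [hev.extDeriv_eq, h, map_sum, sum_apply]
  congr 1
  refine Finset.sum_congr rfl fun i _ => ?_
  refine (congrArg (_ + ·) (metric_christoffel_self (inducedMetric_pos hι y) (e i y) w).symm).trans
    ?_
  rw [chartBilin_self, covDerivSelf]
  exact (DFunLike.congr_fun ((inducedMetric K ι y).map_add _ _) w).symm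

variable {F : Type*} [NormedAddCommGroup F] [NormedSpace ℝ F] [FiniteDimensional ℝ F]
  {L : Type*} [TopologicalSpace L] [ChartedSpace F L] [IsManifold 𝓘(ℝ, F) ∞ L]

/-- Along a submanifold to which the vector field `e` is tangent, `(∇ dj)(a, a)` agrees with
`∇_e e` up to a tangent vector, if `dj a = e`. -/
theorem covHessian_sub_covDerivSelf_mem_range
    (g : ∀ x : Y, TangentSpace 𝓘(ℝ, E) x →L[ℝ] TangentSpace 𝓘(ℝ, E) x →L[ℝ] ℝ)
    {j : L → Y} {s : L} (hj : ContMDiff 𝓘(ℝ, F) 𝓘(ℝ, E) ∞ j)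
    (hinj : Function.Injective (mfderiv 𝓘(ℝ, F) 𝓘(ℝ, E) j s))
    {e : ∀ x : Y, TangentSpace 𝓘(ℝ, E) x}
    (he : ContMDiffAt 𝓘(ℝ, E) (𝓘(ℝ, E).prod 𝓘(ℝ, E)) ∞
      (fun x => (⟨x, e x⟩ : TangentBundle 𝓘(ℝ, E) Y)) (j s))
    (htan : ∀ᶠ x in 𝓝 s, e (j x) ∈ LinearMap.range (mfderiv 𝓘(ℝ, F) 𝓘(ℝ, E) j x).toLinearMap)
    {a : TangentSpace 𝓘(ℝ, F) s} (ha : mfderiv 𝓘(ℝ, F) 𝓘(ℝ, E) j s a = e (j s)) :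
    covHessian g j s a a - covDerivSelf g e (j s) ∈
      LinearMap.range (mfderiv 𝓘(ℝ, F) 𝓘(ℝ, E) j s).toLinearMap := by
  have hjs := hj.mdifferentiable (by simp)
  have hmf := mfderiv_eq_fderiv_writtenInExtChartAt (hjs s)
  set f := writtenInExtChartAt 𝓘(ℝ, F) 𝓘(ℝ, E) s j with hf
  set z := extChartAt 𝓘(ℝ, F) s s with hz
  have hfz : f z = extChartAt 𝓘(ℝ, E) (j s) (j s) := by
    simp [hf, hz, writtenInExtChartAt]
  have hfs : ContDiffAt ℝ 2 f z := by
    have h := ((contMDiffAt_iff (I := 𝓘(ℝ, F)) (I' := 𝓘(ℝ, E))).1 (hj s)).2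
    simp only [modelWithCornersSelf_coe, range_id, contDiffWithinAt_univ] at h
    exact h.of_le (WithTop.coe_le_coe.2 le_top)
  have hed : DifferentiableAt ℝ (chartField e (j s)) (f z) := by
    rw [hfz]
    exact (contDiffAt_chartField he).differentiableAt (by simp)
  -- tangency of `e` to the submanifold, read in the charts
  have htan' : ∀ᶠ y in 𝓝 z, ∃ b, fderiv ℝ f y b = chartField e (j s) (f y) := by
    have hcont : ∀ᶠ x in 𝓝 s, j x ∈ (extChartAt 𝓘(ℝ, E) (j s)).source :=
      hj.continuous.continuousAt.eventually (extChartAt_source_mem_nhds (j s))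
    filter_upwards [eventually_mem_target (E := F) s, eventually_extChartAt_symm (E := F) htan,
      eventually_extChartAt_symm (E := F) hcont] with y hy hby hjy
    set x := (extChartAt 𝓘(ℝ, F) s).symm y with hx
    have hxs : x ∈ (extChartAt 𝓘(ℝ, F) s).source := (extChartAt 𝓘(ℝ, F) s).map_target hy
    have hxy : extChartAt 𝓘(ℝ, F) s x = y := (extChartAt 𝓘(ℝ, F) s).right_inv hy
    obtain ⟨b, hb⟩ : ∃ b, mfderiv 𝓘(ℝ, F) 𝓘(ℝ, E) j x b = e (j x) := hby
    refine ⟨chartCoord s x b, ?_⟩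
    have h := fderiv_writtenInExtChartAt (hjs x) hxs hjy b
    rw [hxy] at h
    refine h.trans ?_
    have hfy : f y = extChartAt 𝓘(ℝ, E) (j s) (j x) := rfl
    rw [hfy, chartField_eq hjy]
    exact congrArg _ hb
  have hfield : chartField e (j s) (f z) = e (j s) := by rw [hfz, chartField_self]
  have ha' : fderiv ℝ f z a = chartField e (j s) (f z) := by
    rw [hfield, ← ha, hmf]
    rfl
  have hinj' : Function.Injective (fderiv ℝ f z) := by
    rw [← hmf]
    exact hinj
  have key := fderiv_sub_hessian_mem_range hfs hinj' hed htan' ha'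
  rw [hfield, hfz] at key
  have hcov : covHessian g j s a a - covDerivSelf g e (j s) =
      fderiv ℝ (fderiv ℝ f) z a a -
        fderiv ℝ (chartField e (j s)) (extChartAt 𝓘(ℝ, E) (j s) (j s)) (e (j s)) := by
    have h1 : fderiv ℝ f z a = e (j s) := ha'.trans hfield
    rw [covHessian_eq, covDerivSelf, ← hf, ← hz, h1]
    exact add_sub_add_right_eq_sub _ _ _
  rw [hcov, hmf]
  exact key

/-- At a point of a leaf, the leafwise volume form of an adapted frame is relatively closed if
and only if the mean curvature vector, computed in this frame, vanishes, i.e. `∑ i, (∇ dj)(aᵢ, aᵢ)`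
has no normal component. -/
theorem relativelyClosed_iff_sum_covHessian_mem_range
    (hι : IsCoisotropicSubmanifold (E' := E) K ι) {j : L → Y}
    (hj : IsIntegralManifold (E' := E) (F := F) K ι j) {s : L} {p : ℕ} {U : Set Y}
    {e : Fin p → ∀ y : Y, TangentSpace 𝓘(ℝ, E) y} (he : IsLeafFrame (E' := E) K ι U e)
    (hs : j s ∈ U) {a : Fin p → TangentSpace 𝓘(ℝ, F) s}
    (ha : ∀ i, mfderiv 𝓘(ℝ, F) 𝓘(ℝ, E) j s (a i) = e i (j s)) :
    (∀ v : Fin (p + 1) → TangentSpace 𝓘(ℝ, E) (j s),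
      (∀ i : Fin p, v i.castSucc ∈ nullDistribution (E' := E) K ι (j s)) →
      mextDeriv (leafVolumeForm K ι e) (j s) v = 0) ↔
    ∑ i, covHessian (inducedMetric K ι) j s (a i) (a i) ∈
      LinearMap.range (mfderiv 𝓘(ℝ, F) 𝓘(ℝ, E) j s).toLinearMap := by
  have hU : U ∈ 𝓝 (j s) := he.isOpen.mem_nhds hs
  have hon := he.orthonormal _ hs
  -- `∑ i, (∇ dj)(aᵢ, aᵢ)` may be replaced by `∑ i, ∇_{eᵢ} eᵢ`
  have hsum : (∑ i, covHessian (inducedMetric K ι) j s (a i) (a i)) -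
      ∑ i, covDerivSelf (inducedMetric K ι) (e i) (j s) ∈
      LinearMap.range (mfderiv 𝓘(ℝ, F) 𝓘(ℝ, E) j s).toLinearMap := by
    rw [← Finset.sum_sub_distrib]
    refine Submodule.sum_mem _ fun i _ => ?_
    refine covHessian_sub_covDerivSelf_mem_range _ hj.smooth (hj.immersion s)
      ((he.smooth i).contMDiffAt hU) ?_ (ha i)
    filter_upwards [hj.smooth.continuous.continuousAt.eventually hU] with x hx
    rw [hj.range_eq, ← he.span_eq _ hx]
    exact Submodule.subset_span ⟨i, rfl⟩
  rw [← Submodule.sub_mem_iff_left _ hsum, sub_sub_cancel, hj.range_eq, ← he.span_eq _ hs]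
  refine Iff.trans ?_ (mem_span_iff_forall_orthogonal (V := E) (B := inducedMetric K ι (j s))
    (e := fun i => e i (j s)) (inducedMetric_pos hι (j s)) hon _).symm
  constructor
  · intro h w hw
    have h1 := mextDeriv_leafVolumeForm_cons hι he hs hw
    have h2 : mextDeriv (leafVolumeForm K ι e) (j s) (Fin.cons w fun i => e i (j s)) = 0 := by
      refine (map_cons_eq_zero_iff_map_snoc (V := E)
        (mextDeriv (leafVolumeForm K ι e) (j s)).toAlternatingMap w fun i => e i (j s)).2
        (h _ fun i => ?_)
      exact Set.mem_of_eq_of_mem (Fin.snoc_castSucc (α := fun _ => E) w (fun i => e i (j s)) i)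
        (Submodule.subset_span ⟨i, rfl⟩)
    exact neg_eq_zero.1 (h1.symm.trans h2)
  · intro h v hv
    refine eq_zero_of_map_cons_eq_zero (V := E)
      (mextDeriv (leafVolumeForm K ι e) (j s)).toAlternatingMap
      (linearIndependent_of_orthonormal (V := E) hon)
      (exists_add_orthogonal (V := E) hon) (fun w hw => ?_) v hv
    refine (mextDeriv_leafVolumeForm_cons hι he hs hw).trans ?_
    exact neg_eq_zero.2 (h w hw)

end MeanCurvature

end Coisotropic

end

/-- A leaf of the null foliation of a coisotropic submanifold `Y` of dimension `n + k` of an almost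
Kähler manifold `X` of dimension `2n` is minimal in `Y` if and only if the leafwise volume form of
`Y` is relatively closed on it. -/
theorem theoremA2 (n k : ℕ) (hk : k ≤ n)
    {X : Type*} [TopologicalSpace X] [T2Space X] [SecondCountableTopology X]
    [ChartedSpace (EuclideanSpace ℝ (Fin (2 * n))) X] [IsManifold (𝓘(ℝ, EuclideanSpace ℝ (Fin (2 * n)))) ∞ X]
    (K : Coisotropic.AlmostKahlerStructure (EuclideanSpace ℝ (Fin (2 * n))) X)
    {Y : Type*} [TopologicalSpace Y] [T2Space Y] [SecondCountableTopology Y]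
    [ChartedSpace (EuclideanSpace ℝ (Fin (n + k))) Y] [IsManifold (𝓘(ℝ, EuclideanSpace ℝ (Fin (n + k)))) ∞ Y]
    (ι : Y → X)
    (hι : Coisotropic.IsCoisotropicSubmanifold (E' := EuclideanSpace ℝ (Fin (n + k))) K ι)
    {L : Type*} [TopologicalSpace L]
    [ChartedSpace (EuclideanSpace ℝ (Fin (n - k))) L] [IsManifold (𝓘(ℝ, EuclideanSpace ℝ (Fin (n - k)))) ∞ L]
    (j : L → Y)
    (hj : Coisotropic.IsLeaf (E' := EuclideanSpace ℝ (Fin (n + k)))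
      (F := EuclideanSpace ℝ (Fin (n - k))) K ι j) :
    Coisotropic.IsMinimalSubmanifold (E := EuclideanSpace ℝ (Fin (n + k)))
        (F := EuclideanSpace ℝ (Fin (n - k))) (n - k) (Coisotropic.inducedMetric K ι) j ↔
      Coisotropic.IsRelativelyClosedOn (E' := EuclideanSpace ℝ (Fin (n + k))) (n - k) K ι
        (Set.range j) := by
  have hrange := hj.integral.range_eq
  constructor
  · rintro hmin U e he _ ⟨hU, s, rfl⟩
    -- the frame at `j s` is the image of an orthonormal basis of the tangent space of the leaf
    have hex (i : Fin (n - k)) : ∃ a, mfderiv 𝓘(ℝ, EuclideanSpace ℝ (Fin (n - k)))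
        𝓘(ℝ, EuclideanSpace ℝ (Fin (n + k))) j s a = e i (j s) := by
      have : e i (j s) ∈ Coisotropic.nullDistribution
          (E' := EuclideanSpace ℝ (Fin (n + k))) K ι (j s) := by
        rw [← he.span_eq _ hU]
        exact Submodule.subset_span ⟨i, rfl⟩
      rw [← hrange] at this
      exact this
    choose a ha using hex
    refine (Coisotropic.relativelyClosed_iff_sum_covHessian_mem_range hι hj.integral he hU ha).2 ?_
    have h := (hmin s).2 a fun i l => by rw [ha, ha, he.orthonormal _ hU]
    rwa [sub_zero] at h
  -- conversely, an orthonormal basis of the tangent space of the leaf extends to an adapted frame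
  · refine fun hclosed s => ⟨fun u => by rw [map_zero]; rfl, fun a horth => ?_⟩
    have hmem (i : Fin (n - k)) : mfderiv 𝓘(ℝ, EuclideanSpace ℝ (Fin (n - k)))
        𝓘(ℝ, EuclideanSpace ℝ (Fin (n + k))) j s (a i) ∈ Coisotropic.nullDistribution
          (E' := EuclideanSpace ℝ (Fin (n + k))) K ι (j s) := by
      rw [← hrange]
      exact ⟨a i, rfl⟩
    obtain ⟨U, e, he, hU, hea⟩ := Coisotropic.exists_isLeafFrame hι (p := n - k)
      (by simp only [finrank_euclideanSpace_fin]; omega) (j s) _ hmem horth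
    rw [sub_zero]
    exact (Coisotropic.relativelyClosed_iff_sum_covHessian_mem_range hι hj.integral he hU
      fun i => (hea i).symm).1 fun v hv => hclosed U e he _ ⟨hU, s, rfl⟩ v hv
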